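/- **Words.** Let $\bar P_1=R$ and let $\bar P_{n+1}$ be obtained from $\bar P_n$ by the substitution $R\to RL$, $L\to R^2L$ (the Pell cascade). Let $P_0=0$, $P_1=1$, $P_{n+2}=2P_{n+1}+P_n$ be the Pell numbers. For a word $\bar W$ in the letters $L,R$, let $\bar W|_C=K_1\cdots K_{|\bar W|}$ be $\bar W$ with its last letter replaced by $C$, and define its finite degree kneading determinant $$D_{\bar W}(x)=\sum_{k=0}^{|\bar W|-1}\Theta^k x^k,\qquad \Theta^0=1,\quad \Theta^k=\prod_{i=1}^k\epsilon_i,$$ with $\epsilon_i=+1$ if $K_i=L$ and $\epsilon_i=-1$ if $K_i=R$. Write $D_{P_n}=D_{\bar P_n}$. **Entropies.** A unimodal map is a continuous map $f$ of an interval $[a,b]$ into itself which, for some $c\in(a,b)$, is strictly increasing on $[a,c]$ and strictly decreasing on $[c,b]$. It has the superstable word $\bar W|_C$ if the itinerary of $f(c),f^2(c),\dots$ (letter $L$, $C$, $R$ for a point to the left of, at, or to the right of $c$) is the periodic sequence $(\bar W|_C)^\infty$. Let $h_n$ denote the topological entropy of any unimodal map with superstable word $\bar P_n|_C$ (by (5)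 it does not depend on the map for $n\ge2$). **Statement.** 1. $\bar P_{n+2}=\bar P_{n+1}\bar P_n\bar P_{n+1}$ and $|\bar P_n|=P_n$ for all $n\ge 1$. 2. For all $n\ge 2$, $D_{P_{n+1}}(x)=D_{P_n}(x)-x^{P_n}D_{P_{n-1}}(x)+x^{P_n+P_{n-1}}D_{P_n}(x)$. 3. For all $n\ge 2$ the polynomial $D_{P_n}$ has a smallest positive zero $\tau_n$, and $\tau_{n+1}<\tau_n$. 4. $\tau_n\to\tau_\infty$ for some $0<\tau_\infty<1$, and with $\delta_n=\tau_n-\tau_{n+1}$, $$\lim_{n\to\infty}\Big(\frac{\delta_n}{\delta_{n-1}}\Big)^{1/P_n}=\tau_\infty .$$ 5. For every choice of unimodal maps with superstable words $\bar P_n|_C$ ($n\ge 1$), $h_n=-\ln\tau_n$ for all $n\ge2$, and $h_n\to h_\infty:=-\ln\tau_\infty$. Moreover, as $n\to\infty$, $$\frac{h_n-h_{n-1}}{h_{n+1}-h_n}\Big/\exp\Big\{\exp\Big[n\ln(1+\sqrt2)+\ln\Big(\frac{h_\infty}{2\sqrt2}\Big)\Big]\Big\}\longrightarrow 1$$ and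 $$\ln\ln\Big(\frac{h_n-h_{n-1}}{h_{n+1}-h_n}\Big)-\Big[n\ln(1+\sqrt2)+\ln\Big(\frac{h_\infty}{2\sqrt2}\Big)\Big]\longrightarrow 0 .$$ -/

import Mathlib

/-- The alphabet of symbolic dynamics: left of, at, and right of the turning point. -/
inductive Letter where
  | L : Letter
  | C : Letter
  | R : Letter

/-- The substitution `R → RL`, `L → RRL` on single letters (`C` is left unchanged; it does not
occur in the words generated from `R`). -/
def pellSubstLetter : Letter → List Letter
  | Letter.R => [Letter.R, Letter.L]
  | Letter.L => [Letter.R, Letter.R, Letter.L]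
  | Letter.C => [Letter.C]

/-- The substitution applied to every letter of a word. -/
def pellSubst (w : List Letter) : List Letter := w.flatMap pellSubstLetter

/-- The words of the Pell cascade: the first word is `R`, and each further word is obtained from
the preceding one by the substitution. Index `0` is not part of the cascade. -/
def pellWord : ℕ → List Letter
  | 0 => []
  | 1 => [Letter.R]
  | (n + 2) => pellSubst (pellWord (n + 1))

/-- The Pell numbers `0, 1, 2, 5, 12, 29, …`. -/
def pellNumber : ℕ → ℕ
  | 0 => 0
  | 1 => 1
  | (n + 2) => 2 * pellNumber (n + 1) + pellNumber n

/-- The word `w` with its last letter replaced by `C`. -/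
def capC (w : List Letter) : List Letter := w.dropLast ++ [Letter.C]

/-- The infinite periodic sequence `w w w …`, indexed from `0`. -/
def periodicSeq (w : List Letter) (i : ℕ) : Letter := w.getD (i % w.length) Letter.C

/-- The invariant coordinates `Θ⁰ = 1`, `Θᵏ = ε₁ ⋯ εₖ`, where `ε = 1` for the letter `L`,
`ε = -1` for the letter `R`, and `ε = ` the product of the preceding signs for the letter `C`. -/
def invariantCoord (K : ℕ → Letter) : ℕ → ℝ
  | 0 => 1
  | (k + 1) =>
    invariantCoord K k *
      (match K k with
        | Letter.L => 1
        | Letter.R => -1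
        | Letter.C => invariantCoord K k)

/-- The finite degree kneading determinant `∑_{k < |w|} Θᵏ xᵏ` of the superstable word `w|_C`. -/
noncomputable def kneadingDet (w : List Letter) : Polynomial ℝ :=
  ∑ k ∈ Finset.range w.length,
    Polynomial.C (invariantCoord (periodicSeq (capC w)) k) * Polynomial.X ^ k

/-- The set of positive real zeros of a polynomial. -/
def positiveZeros (p : Polynomial ℝ) : Set ℝ := {x | 0 < x ∧ p.eval x = 0}

/-- The smallest positive zero of the kneading determinant of the `n`-th Pell word. -/
noncomputable def pellTau (n : ℕ) : ℝ := sInf (positiveZeros (kneadingDet (pellWord n)))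

/-- The differences `δₙ = τₙ - τₙ₊₁`. -/
noncomputable def pellDelta (n : ℕ) : ℝ := pellTau n - pellTau (n + 1)

/-- `f` restricts to a unimodal map of the interval `[a, b]` with maximum at the interior
point `c`. -/
structure IsUnimodalOn (f : ℝ → ℝ) (a b c : ℝ) : Prop where
  left_lt : a < c
  lt_right : c < b
  continuousOn : ContinuousOn f (Set.Icc a b)
  mapsTo : Set.MapsTo f (Set.Icc a b) (Set.Icc a b)
  strictMonoOn : StrictMonoOn f (Set.Icc a c)
  strictAntiOn : StrictAntiOn f (Set.Icc c b)

/-- The letter describing the position of `x` relative to the turning point `c`. -/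
noncomputable def letterAt (c x : ℝ) : Letter :=
  if x < c then Letter.L else if x = c then Letter.C else Letter.R

/-- The orbit of the turning point `c` under `f` is the superstable periodic orbit described by
the word `w|_C`: the kneading sequence, i.e. the itinerary of `f c, f (f c), …`, is
`(w|_C)(w|_C)…`. -/
def HasSuperstableWord (f : ℝ → ℝ) (c : ℝ) (w : List Letter) : Prop :=
  ∀ i : ℕ, letterAt c (f^[i + 1] c) = periodicSeq (capC w) i

/-- The Bowen–Dinaburg topological entropy of `f` on the interval `[a, b]`, in `[-∞, ∞]`. -/
noncomputable def entropyOn (f : ℝ → ℝ) (a b : ℝ) : EReal :=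
  Dynamics.coverEntropy f (Set.Icc a b)

/-! Write W_n for the words, D_n for their determinants and δ_n = τ_n - τ_{n+1}. Since W_{n+2} =
W_{n+1} W_n W_{n+1} and every W_n has an odd number of letters R, the Horner-type `signPoly` turns
concatenation into the recursion for D_n. At τ_n it collapses to D_{n+1}(τ_n) = -τ_n^{P_n}
D_{n-1}(τ_n) < 0, which forces a smaller zero of D_{n+1} (`isLeast_pellTau_and_pos`).

The mean value theorem, applied to D_n on [τ_{n+1}, τ_n] and to D_{n+2} on [τ_{n+2}, τ_{n+1}], gives
δ_{n+1} = τ_{n+1}^{P_{n+1}} r_n δ_n with r_n a quotient of derivatives (`exists_pellDelta_succ_eq`).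
On [0, 2/3] the D_n' converge uniformly and stay below -1/2, so r_n → 1, and taking roots of order
P_{n+1} gives the limit of the ratios. The δ_n decay so fast that P_n (τ_n - τ_∞) → 0. Hence the
logarithm of the ratio of consecutive entropy differences is P_{n+1} h_{n+1} + o(1) = h_∞
(1+√2)^{n+1} / (2√2) + o(1) (`tendsto_log_ratio_sub`), which yields both asymptotic statements.

For the entropy, the suffix of the word starting at letter k gives a number G k attached to
f^{k+1}(c), with G k = 1 ± t G (k+1). The difference G i - G j acts as a length of the interval
between two orbit points. On either side of c, f stretches this length by at most 1/t if G 0 ≥ 0,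
and by exactly 1/t if G 0 = 0. For t < τ the lengths are positive, so points have at most K t^{-n}
preimages under f^n; at t = τ some finite set has at least C τ^{-n}. Such counts bound the entropy
from above (`coverEntropy_le_log_of_card_preimage_le`) and from below (`log_le_coverEntropy`), so
that it equals -log τ (`coverEntropy_eq_neg_log`). -/

open Polynomial Set Filter Topology

/-! ### Words and their sign polynomials -/

/-- The sign attached to a letter: `1` for `L`, `-1` for `R`, and `0` for `C`. -/
def letterSign : Letter → ℝ
  | Letter.L => 1
  | Letter.C => 0
  | Letter.R => -1

/-- The product of the signs of the letters of a word. -/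
def wordSign (w : List Letter) : ℝ := (w.map letterSign).prod

/-- The polynomial `∑_{k < |w|} ε₁ ⋯ εₖ Xᵏ` attached to a word. -/
noncomputable def signPoly : List Letter → ℝ[X]
  | [] => 0
  | l :: s => 1 + C (letterSign l) * X * signPoly s

@[simp] lemma wordSign_cons (l : Letter) (s : List Letter) :
    wordSign (l :: s) = letterSign l * wordSign s := by simp [wordSign]

lemma wordSign_append (u v : List Letter) : wordSign (u ++ v) = wordSign u * wordSign v := by
  simp [wordSign]

lemma signPoly_append (u v : List Letter) :
    signPoly (u ++ v) = signPoly u + C (wordSign u) * X ^ u.length * signPoly v := by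
  induction u with
  | nil => simp [signPoly, wordSign]
  | cons l s ih =>
    simp only [List.cons_append, signPoly, ih, wordSign_cons, List.length_cons, C_mul]
    ring

lemma invariantCoord_succ_of_ne (K : ℕ → Letter) (k : ℕ) (h : K k ≠ Letter.C) :
    invariantCoord K (k + 1) = invariantCoord K k * letterSign (K k) := by
  rw [invariantCoord]
  cases hK : K k <;> simp_all [letterSign]

lemma invariantCoord_succ_eq_mul_shift (K : ℕ → Letter) (k : ℕ)
    (h : ∀ i ≤ k, K i ≠ Letter.C) :
    invariantCoord K (k + 1) = letterSign (K 0) * invariantCoord (fun i => K (i + 1)) k := by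
  induction k with
  | zero =>
    rw [invariantCoord_succ_of_ne _ _ (h 0 le_rfl)]
    simp [invariantCoord]
  | succ k ih =>
    rw [invariantCoord_succ_of_ne _ _ (h (k + 1) le_rfl), ih fun i hi => h i (by omega),
      invariantCoord_succ_of_ne (fun i => K (i + 1)) k (h (k + 1) le_rfl), mul_assoc]

/-- Agreement of `K` with `w` is needed only before the last letter: the sign of the last letter
multiplies `signPoly [] = 0`. This is why capping the word with `C` is harmless. -/
lemma sum_invariantCoord_eq_signPoly (w : List Letter) (hw : Letter.C ∉ w) (K : ℕ → Letter)
    (hK : ∀ i, i + 1 < w.length → w[i]? = some (K i)) :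
    ∑ k ∈ Finset.range w.length, C (invariantCoord K k) * X ^ k = signPoly w := by
  induction w generalizing K with
  | nil => simp [signPoly]
  | cons l s ih =>
    rw [List.length_cons, Finset.sum_range_succ', signPoly]
    rcases s with _ | ⟨m, s⟩
    · simp [invariantCoord, signPoly]
    · rw [← ih (fun h => hw (List.mem_cons_of_mem _ h)) (fun i => K (i + 1))
        (fun i hi => by simpa using hK (i + 1) (by simpa using hi)), add_comm]
      have h0 : l = K 0 := by simpa using hK 0 (by simp)
      congr 1
      · simp [invariantCoord]
      · rw [Finset.mul_sum]
        refine Finset.sum_congr rfl fun k hk => ?_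
        rw [invariantCoord_succ_eq_mul_shift, ← h0, C_mul]
        · ring
        · intro i hi hC
          have := hK i (by simp at hk ⊢; omega)
          exact hw (hC ▸ List.mem_of_getElem? this)

lemma periodicSeq_capC_of_lt (w : List Letter) (i : ℕ) (hi : i + 1 < w.length) :
    w[i]? = some (periodicSeq (capC w) i) := by
  have hl : (capC w).length = w.length := by simp [capC]; omega
  rw [periodicSeq, hl, Nat.mod_eq_of_lt (by omega), capC, List.getD_append _ _ _ _ (by simp; omega)]
  simp [List.getD_eq_getElem?_getD, List.getElem?_dropLast]
  rw [if_pos (by omega), List.getElem?_eq_getElem (by omega)]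
  simp

lemma periodicSeq_capC_last (w : List Letter) (hw : w ≠ []) :
    periodicSeq (capC w) (w.length - 1) = Letter.C := by
  have h0 : 0 < w.length := List.length_pos_of_ne_nil hw
  have hl : (capC w).length = w.length := by simp [capC]; omega
  rw [periodicSeq, hl, Nat.mod_eq_of_lt (by omega), capC]
  simp [List.getD_eq_getElem?_getD]

lemma kneadingDet_eq_signPoly (w : List Letter) (hw : Letter.C ∉ w) :
    kneadingDet w = signPoly w :=
  sum_invariantCoord_eq_signPoly w hw _ (periodicSeq_capC_of_lt w)

lemma pellSubst_append (u v : List Letter) : pellSubst (u ++ v) = pellSubst u ++ pellSubst v := by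
  simp [pellSubst]

/-- The substitution is a morphism for concatenation, so applying it to the identity for `n` gives
the one for `n + 1`. -/
lemma pellWord_concat (n : ℕ) (hn : 1 ≤ n) :
    pellWord (n + 2) = pellWord (n + 1) ++ pellWord n ++ pellWord (n + 1) := by
  induction n, hn using Nat.le_induction with
  | base => simp [pellWord, pellSubst, pellSubstLetter]
  | succ n hn ih =>
    obtain ⟨m, rfl⟩ := Nat.exists_eq_add_of_le' hn
    have h := congrArg pellSubst ih
    rwa [pellSubst_append, pellSubst_append] at h

lemma C_notMem_pellWord (n : ℕ) : Letter.C ∉ pellWord n := by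
  suffices h : Letter.C ∉ pellWord n ∧ Letter.C ∉ pellWord (n + 1) from h.1
  induction n with
  | zero => simp [pellWord]
  | succ n ih =>
    refine ⟨ih.2, ?_⟩
    rw [pellWord]
    have := ih.2
    intro hC
    simp only [pellSubst, List.mem_flatMap] at hC
    obtain ⟨l, hl, hC⟩ := hC
    cases l <;> simp_all [pellSubstLetter]

lemma length_pellWord (n : ℕ) (hn : 1 ≤ n) : (pellWord n).length = pellNumber n := by
  suffices h : (pellWord n).length = pellNumber n ∧
      (pellWord (n + 1)).length = pellNumber (n + 1) from h.1
  induction n, hn using Nat.le_induction with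
  | base => simp [pellWord, pellNumber, pellSubst, pellSubstLetter]
  | succ n hn ih =>
    refine ⟨ih.2, ?_⟩
    rw [pellWord_concat n hn, List.length_append, List.length_append, ih.1, ih.2, pellNumber]
    omega

lemma wordSign_pellWord (n : ℕ) (hn : 1 ≤ n) : wordSign (pellWord n) = -1 := by
  suffices h : wordSign (pellWord n) = -1 ∧ wordSign (pellWord (n + 1)) = -1 from h.1
  induction n, hn using Nat.le_induction with
  | base => simp [pellWord, wordSign, pellSubst, pellSubstLetter, letterSign]
  | succ n hn ih =>
    refine ⟨ih.2, ?_⟩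
    rw [pellWord_concat n hn, wordSign_append, wordSign_append, ih.1, ih.2]
    norm_num

/-- Each block contributes its own polynomial, shifted by the length and multiplied by the sign of
what precedes it. All words have sign -1, so the three blocks enter with signs +, -, +. -/
lemma kneadingDet_pellWord_succ (n : ℕ) (hn : 2 ≤ n) :
    kneadingDet (pellWord (n + 1)) =
      kneadingDet (pellWord n) - X ^ pellNumber n * kneadingDet (pellWord (n - 1))
        + X ^ (pellNumber n + pellNumber (n - 1)) * kneadingDet (pellWord n) := by
  obtain ⟨m, rfl⟩ : ∃ m, n = m + 1 := ⟨n - 1, by omega⟩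
  have hm : 1 ≤ m := by omega
  simp only [kneadingDet_eq_signPoly _ (C_notMem_pellWord _), Nat.add_sub_cancel]
  rw [pellWord_concat m hm, signPoly_append, signPoly_append, wordSign_append,
    List.length_append, length_pellWord _ hm, length_pellWord (m + 1) (by omega),
    wordSign_pellWord _ hm, wordSign_pellWord (m + 1) (by omega)]
  simp
  ring

/-! ### Upper bound for the entropy of interval maps by counting preimages -/

lemma ContinuousOn.iterate_of_mapsTo {X : Type*} [TopologicalSpace X] {f : X → X} {s : Set X}
    (hf : ContinuousOn f s) (hm : MapsTo f s s) (n : ℕ) : ContinuousOn f^[n] s := by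
  induction n with
  | zero => exact continuousOn_id
  | succ n ih => exact ih.comp hf hm

/-- The set is a grid of mesh ε. An interval of length at least ε would contain the first grid point
not below its left end. -/
lemma exists_finset_forall_dist_lt (a b : ℝ) {ε : ℝ} (hε : 0 < ε) :
    ∃ E : Finset ℝ, ∀ u v, a ≤ u → u ≤ v → v ≤ b → (∀ e ∈ E, e ∉ Icc u v) → v - u < ε := by
  classical
  refine ⟨(Finset.range (⌈(b - a) / ε⌉₊ + 1)).image fun k : ℕ => a + k * ε,
    fun u v hau huv hvb h => ?_⟩
  by_contra! hle
  have h0 : 0 ≤ (u - a) / ε := div_nonneg (by linarith) hε.le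
  have h1 : u - a ≤ ⌈(u - a) / ε⌉₊ * ε := (div_le_iff₀ hε).1 (Nat.le_ceil _)
  have h2 : ⌈(u - a) / ε⌉₊ * ε < u - a + ε := by
    have := (mul_lt_mul_iff_left₀ hε).2 (Nat.ceil_lt_add_one h0)
    rwa [add_mul, one_mul, div_mul_cancel₀ _ hε.ne'] at this
  refine h _ (Finset.mem_image_of_mem _ (Finset.mem_range.2 (Nat.lt_succ_of_le
    (Nat.ceil_mono (a := (u - a) / ε) ?_)))) ⟨by linarith, by linarith⟩
  gcongr
  linarith

lemma exists_finset_of_forall_card_le {α : Type*} {S : Set α} {M : ℕ}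
    (h : ∀ s : Finset α, ↑s ⊆ S → s.card ≤ M) : ∃ s : Finset α, ↑s = S ∧ s.card ≤ M := by
  have hfin : S.Finite := by
    by_contra hinf
    obtain ⟨t, ht, hc⟩ := (show S.Infinite from hinf).exists_subset_card_eq (M + 1)
    have := h t ht
    omega
  exact ⟨hfin.toFinset, hfin.coe_toFinset, h _ hfin.coe_toFinset.le⟩

/-- If preimages of points under `fⁿ` have at most `K rⁿ` elements, then every dynamical net has
at most `C rⁿ` elements. -/
lemma exists_card_net_le {f : ℝ → ℝ} {a b r K ε : ℝ} (hf : ContinuousOn f (Icc a b))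
    (hm : MapsTo f (Icc a b) (Icc a b)) (hr : 1 < r) (hK : 0 ≤ K) (hε : 0 < ε)
    (hcount : ∀ (n : ℕ) (y : ℝ) (s : Finset ℝ), (∀ x ∈ s, x ∈ Icc a b ∧ f^[n] x = y) →
      (s.card : ℝ) ≤ K * r ^ n) :
    ∃ C : ℝ, 0 ≤ C ∧ ∀ (n : ℕ) (s : Finset ℝ),
      Dynamics.IsDynNetIn f (Icc a b) {p : ℝ × ℝ | dist p.1 p.2 < ε} n s →
        (s.card : ℝ) ≤ C * r ^ n := by
  classical
  obtain ⟨E, hE⟩ := exists_finset_forall_dist_lt a b hε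
  have hr1 : 0 < r - 1 := by linarith
  refine ⟨2 * (E.card * K / (r - 1)) + 1, by positivity, fun n s hs => ?_⟩
  have hpre : ∀ (j : ℕ) (e : ℝ), ∃ t : Finset ℝ, ↑t = {x | x ∈ Icc a b ∧ f^[j] x = e} ∧
      t.card ≤ ⌊K * r ^ j⌋₊ := fun j e =>
    exists_finset_of_forall_card_le fun t ht => Nat.le_floor (hcount j e t fun x hx => ht hx)
  choose t ht htc using hpre
  -- `A` collects the points that visit the grid `E` before time `n`; the geometric sum bounds its
  -- size.
  set A : Finset ℝ := (Finset.range n).biUnion fun j => E.biUnion fun e => t j e with hA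
  have hAmem : ∀ x, x ∈ A ↔ ∃ j < n, ∃ e ∈ E, x ∈ Icc a b ∧ f^[j] x = e := by
    intro x
    have : ∀ j e, x ∈ t j e ↔ x ∈ Icc a b ∧ f^[j] x = e := fun j e => by
      rw [← Finset.mem_coe, ht]; rfl
    simp [hA, this]
  have hAcard : (A.card : ℝ) ≤ E.card * K / (r - 1) * r ^ n := by
    calc (A.card : ℝ) ≤ ∑ j ∈ Finset.range n, ∑ e ∈ E, ((t j e).card : ℝ) := by
          have h1 : A.card ≤ ∑ j ∈ Finset.range n, ∑ e ∈ E, (t j e).card :=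
            Finset.card_biUnion_le.trans (Finset.sum_le_sum fun j _ => Finset.card_biUnion_le)
          exact_mod_cast h1
      _ ≤ ∑ j ∈ Finset.range n, ∑ e ∈ E, K * r ^ j := by
          gcongr with j _ e _
          exact (Nat.cast_le.2 (htc j e)).trans (Nat.floor_le (by positivity))
      _ = E.card * K * ((r ^ n - 1) / (r - 1)) := by
          rw [← geom_sum_eq hr.ne']
          simp [Finset.mul_sum, mul_assoc]
      _ ≤ _ := by
          rw [div_mul_eq_mul_div, ← mul_div_assoc]
          gcongr
          linarith
  -- The sum of the weak and the strict count is constant on [x, y] only if no point of `A` lies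
  -- there. Then no image f^j[x, y] with j < n meets the grid, so x and y stay ε-close and `y` lies
  -- in both dynamical balls, which should be disjoint.
  have key : ∀ x ∈ s, ∀ y ∈ s, x < y →
      (A.filter (· ≤ x)).card + (A.filter (· < x)).card <
        (A.filter (· ≤ y)).card + (A.filter (· < y)).card := by
    intro x hx y hy hxy
    have hsub1 : A.filter (· ≤ x) ⊆ A.filter (· ≤ y) :=
      Finset.monotone_filter_right _ fun z _ hz => le_trans hz hxy.le
    have hsub2 : A.filter (· < x) ⊆ A.filter (· < y) :=
      Finset.monotone_filter_right _ fun z _ hz => lt_trans hz hxy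
    by_contra! hle
    have e1 := Finset.eq_of_subset_of_card_le hsub1
      (by have := Finset.card_le_card hsub2; omega)
    have e2 := Finset.eq_of_subset_of_card_le hsub2
      (by have := Finset.card_le_card hsub1; omega)
    have hno : ∀ z ∈ A, z ∉ Icc x y := by
      intro z hz hzI
      have h1 : z ∈ A.filter (· ≤ x) := e1 ▸ Finset.mem_filter.2 ⟨hz, hzI.2⟩
      have h2 : z = x := le_antisymm (Finset.mem_filter.1 h1).2 hzI.1
      have h3 : z ∈ A.filter (· < x) := e2 ▸ Finset.mem_filter.2 ⟨hz, h2 ▸ hxy⟩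
      exact absurd (Finset.mem_filter.1 h3).2 (by simp [h2])
    have hxI := hs.1 hx
    have hyI := hs.1 hy
    have hsub : Icc x y ⊆ Icc a b := Icc_subset_Icc hxI.1 hyI.2
    refine absurd (hs.2 hx hy hxy.ne) (Set.not_disjoint_iff.2 ⟨y, ?_, ?_⟩)
    · refine Dynamics.mem_ball_dynEntourage.2 fun j hj => ?_
      have hIV := intermediate_value_uIcc (f := f^[j]) (a := x) (b := y)
        (by rw [uIcc_of_le hxy.le]; exact (hf.iterate_of_mapsTo hm j).mono hsub)
      rw [uIcc_of_le hxy.le] at hIV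
      have hju := hm.iterate j hxI
      have hjv := hm.iterate j hyI
      have := hE (min (f^[j] x) (f^[j] y)) (max (f^[j] x) (f^[j] y)) (le_min hju.1 hjv.1)
        min_le_max (max_le hju.2 hjv.2) fun e he heI => by
          obtain ⟨z, hz, hze⟩ := hIV heI
          exact hno z ((hAmem z).2 ⟨j, hj, e, he, hsub hz, hze⟩) hz
      rw [max_sub_min_eq_abs] at this
      change dist _ _ < ε
      rwa [dist_comm, Real.dist_eq]
    · exact Dynamics.mem_ball_dynEntourage.2 fun j hj => by
        change dist _ _ < ε
        simpa using hε
  have hcard : s.card ≤ (Finset.range (2 * A.card + 1)).card := by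
    refine Finset.card_le_card_of_injOn
      (fun x => (A.filter (· ≤ x)).card + (A.filter (· < x)).card) (fun x _ => ?_) ?_
    · have h1 := Finset.card_filter_le A (· ≤ x)
      have h2 := Finset.card_filter_le A (· < x)
      simp only [Finset.coe_range, mem_Iio]
      omega
    · intro x hx y hy hxy
      rcases lt_trichotomy x y with h | h | h
      · exact absurd hxy (key x hx y hy h).ne
      · exact h
      · exact absurd hxy (key y hy x hx h).ne'
  rw [Finset.card_range] at hcard
  have h1 : (s.card : ℝ) ≤ 2 * A.card + 1 := by exact_mod_cast hcard
  have h2 : 1 ≤ r ^ n := one_le_pow₀ hr.le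
  nlinarith

/-- Entropy is computed with nets, whose size is bounded by a constant (depending on ε) times rⁿ;
the constant does not affect the growth rate. -/
theorem coverEntropy_le_log_of_card_preimage_le {f : ℝ → ℝ} {a b r K : ℝ}
    (hf : ContinuousOn f (Icc a b)) (hm : MapsTo f (Icc a b) (Icc a b)) (hr : 1 < r) (hK : 0 ≤ K)
    (hcount : ∀ (n : ℕ) (y : ℝ) (s : Finset ℝ), (∀ x ∈ s, x ∈ Icc a b ∧ f^[n] x = y) →
      (s.card : ℝ) ≤ K * r ^ n) :
    Dynamics.coverEntropy f (Icc a b) ≤ (Real.log r : EReal) := by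
  rw [Dynamics.coverEntropy_eq_iSup_basis_netEntropyEntourage Metric.uniformity_basis_dist]
  refine iSup₂_le fun ε hε => ?_
  obtain ⟨C, hC, h⟩ := exists_card_net_le hf hm hr hK hε hcount
  have hlog : ENNReal.log (ENNReal.ofReal r) = (Real.log r : EReal) :=
    ENNReal.log_ofReal_of_pos (by linarith)
  rw [← hlog, ← ExpGrowth.expGrowthSup_pow]
  refine ExpGrowth.expGrowthSup_le_of_eventually_le (b := ENNReal.ofReal C) ENNReal.ofReal_ne_top
    (Eventually.of_forall fun n => ?_)
  rw [← ENNReal.ofReal_pow (by linarith), ← ENNReal.ofReal_mul hC]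
  have : Dynamics.netMaxcard f (Icc a b) {p : ℝ × ℝ | dist p.1 p.2 < ε} n ≤
      (⌊C * r ^ n⌋₊ : ℕ∞) :=
    iSup₂_le fun s hs => Nat.cast_le.2 (Nat.le_floor (h n s hs))
  refine (ENat.toENNReal_mono this).trans ?_
  rw [ENat.toENNReal_coe, ← ENNReal.ofReal_natCast]
  exact ENNReal.ofReal_le_ofReal (Nat.floor_le (by positivity))

/-! ### Lower bound for the entropy of unimodal maps by counting preimages -/

namespace IsUnimodalOn

variable {f : ℝ → ℝ} {a b c : ℝ}

lemma mem (hf : IsUnimodalOn f a b c) : c ∈ Icc a b := ⟨hf.left_lt.le, hf.lt_right.le⟩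

/-- A unimodal map is at most two-to-one. -/
lemma card_fiber_le (hf : IsUnimodalOn f a b c) (y : ℝ) (s : Finset ℝ)
    (hs : ∀ x ∈ s, x ∈ Icc a b ∧ f x = y) : s.card ≤ 2 := by
  classical
  have h1 : (s.filter (· ≤ c)).card ≤ 1 := by
    refine Finset.card_le_one.2 fun x hx x' hx' => ?_
    simp only [Finset.mem_filter] at hx hx'
    exact hf.strictMonoOn.injOn ⟨(hs x hx.1).1.1, hx.2⟩ ⟨(hs x' hx'.1).1.1, hx'.2⟩
      ((hs x hx.1).2.trans (hs x' hx'.1).2.symm)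
  have h2 : (s.filter (¬ · ≤ c)).card ≤ 1 := by
    refine Finset.card_le_one.2 fun x hx x' hx' => ?_
    simp only [Finset.mem_filter, not_le] at hx hx'
    exact hf.strictAntiOn.injOn ⟨hx.2.le, (hs x hx.1).1.2⟩ ⟨hx'.2.le, (hs x' hx'.1).1.2⟩
      ((hs x hx.1).2.trans (hs x' hx'.1).2.symm)
  have := Finset.card_filter_add_card_filter_not (s := s) (p := (· ≤ c))
  omega

lemma card_iterate_fiber_le (hf : IsUnimodalOn f a b c) (n : ℕ) (y : ℝ) (s : Finset ℝ)
    (hs : ∀ x ∈ s, x ∈ Icc a b ∧ f^[n] x = y) : s.card ≤ 2 ^ n := by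
  classical
  induction n generalizing s with
  | zero =>
    refine Finset.card_le_one.2 fun x hx x' hx' => ?_
    exact (hs x hx).2.trans (hs x' hx').2.symm
  | succ n ih =>
    rw [pow_succ']
    refine (Finset.card_le_mul_card_image (f := f) s 2 fun z _ => ?_).trans
      (Nat.mul_le_mul_left 2 (ih (s.image f) ?_))
    · refine hf.card_fiber_le z _ fun x hx => ?_
      rw [Finset.mem_filter] at hx
      exact ⟨(hs x hx.1).1, hx.2⟩
    · intro z hz
      obtain ⟨x, hx, rfl⟩ := Finset.mem_image.1 hz
      exact ⟨hf.mapsTo (hs x hx).1, (hs x hx).2⟩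

/-- By the intermediate value theorem, an interval whose earlier images avoid c is kept by each
iterate on one side of c, where f is injective. -/
lemma iterate_ne_of_forall_ne (hf : IsUnimodalOn f a b c) {x y : ℝ} (hx : x ∈ Icc a b)
    (hy : y ∈ Icc a b) (hxy : x < y) (n : ℕ) (h : ∀ z ∈ Icc x y, ∀ j < n, f^[j] z ≠ c) :
    f^[n] x ≠ f^[n] y := by
  induction n with
  | zero => exact hxy.ne
  | succ n ih =>
    have hne := ih fun z hz j hj => h z hz j (by omega)
    rw [Function.iterate_succ_apply', Function.iterate_succ_apply']
    have hIV := intermediate_value_uIcc (f := f^[n]) (a := x) (b := y)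
      (by rw [uIcc_of_le hxy.le]
          exact (hf.continuousOn.iterate_of_mapsTo hf.mapsTo n).mono (Icc_subset_Icc hx.1 hy.2))
    rw [uIcc_of_le hxy.le] at hIV
    have hc : c ∉ uIcc (f^[n] x) (f^[n] y) := fun hc => by
      obtain ⟨z, hz, hzc⟩ := hIV hc
      exact h z hz n (by omega) hzc
    have hxn := hf.mapsTo.iterate n hx
    have hyn := hf.mapsTo.iterate n hy
    rw [mem_uIcc] at hc
    push Not at hc
    rcases le_total (f^[n] x) c with h1 | h1
    · have h2 := hc.1 h1
      exact fun h => hne (hf.strictMonoOn.injOn ⟨hxn.1, h1⟩ ⟨hyn.1, h2.le⟩ h)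
    · have h2 : c ≤ f^[n] y := by
        by_contra! h3
        exact absurd (hc.2 h3.le) (not_lt.2 h1)
      exact fun h => hne (hf.strictAntiOn.injOn ⟨h1, hxn.2⟩ ⟨h2, hyn.2⟩ h)

/-- On a sufficiently small ball, `fᵏ` is at most three-to-one. -/
lemma exists_ball_card_fiber_le (hf : IsUnimodalOn f a b c) (k : ℕ) :
    ∃ ε > 0, ∀ (u w : ℝ) (s : Finset ℝ),
      (∀ x ∈ s, x ∈ Icc a b ∧ dist u x < ε ∧ f^[k] x = w) → s.card ≤ 3 := by
  classical
  have hpre : ∀ j : ℕ, {x | x ∈ Icc a b ∧ f^[j] x = c}.Finite := fun j => by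
    obtain ⟨t, ht, -⟩ := exists_finset_of_forall_card_le (S := {x | x ∈ Icc a b ∧ f^[j] x = c})
      fun s hs => hf.card_iterate_fiber_le j c s fun x hx => hs hx
    exact ht ▸ t.finite_toSet
  -- `S` is the finite set of turning points of f^k. A ball of radius half their minimal gap
  -- contains at most one of them, `p`. A fibre then has at most one point to the left of `p`, one
  -- at `p` and one to the right.
  set S : Set ℝ := ⋃ j ∈ Iio k, {x | x ∈ Icc a b ∧ f^[j] x = c} with hS
  have hSfin : S.Finite := (finite_Iio k).biUnion fun j _ => hpre j
  obtain ⟨δ, hδ, hgap⟩ : ∃ δ > 0, ∀ p ∈ S, ∀ q ∈ S, p ≠ q → δ ≤ dist p q := by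
    by_cases hnt : S.Nontrivial
    · exact ⟨S.infsep, hSfin.infsep_pos_iff_nontrivial.2 hnt, fun p hp q hq hpq =>
        Set.infsep_le_dist_of_mem hp hq hpq⟩
    · refine ⟨1, one_pos, fun p hp q hq hpq => absurd (not_nontrivial_iff.1 hnt hp hq) hpq⟩
  refine ⟨δ / 2, by positivity, fun u w s hs => ?_⟩
  obtain ⟨p, hp⟩ : ∃ p, ∀ q ∈ S, dist u q < δ / 2 → q = p := by
    by_cases h : ∃ p ∈ S, dist u p < δ / 2
    · obtain ⟨p, hpS, hpu⟩ := h
      refine ⟨p, fun q hq hqu => ?_⟩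
      by_contra hne
      have h1 := hgap q hq p hpS hne
      have h2 := dist_triangle_left q p u
      linarith
    · push Not at h
      exact ⟨0, fun q hq hqu => absurd hqu (not_lt.2 (h q hq))⟩
  have key : ∀ x ∈ s, ∀ y ∈ s, x < y → ¬ (x ≤ p ∧ p ≤ y) → False := by
    intro x hx y hy hxy hpn
    refine hf.iterate_ne_of_forall_ne (hs x hx).1 (hs y hy).1 hxy k (fun z hz j hj hzc => ?_)
      ((hs x hx).2.2.trans (hs y hy).2.2.symm)
    have hzS : z ∈ S := mem_biUnion (mem_Iio.2 hj)
      ⟨⟨(hs x hx).1.1.trans hz.1, hz.2.trans (hs y hy).1.2⟩, hzc⟩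
    have hzd : dist u z < δ / 2 := by
      have h1 := (hs x hx).2.1
      have h2 := (hs y hy).2.1
      rw [Real.dist_eq, abs_lt] at h1 h2 ⊢
      constructor <;> linarith [hz.1, hz.2, h1.1, h1.2, h2.1, h2.2]
    have := hp z hzS hzd
    exact hpn ⟨this ▸ hz.1, this ▸ hz.2⟩
  refine (Finset.card_le_card_of_injOn (t := Finset.range 3)
    (fun x => if x < p then 0 else if x = p then 1 else 2) (fun x _ => ?_) ?_).trans
    (Finset.card_range 3).le
  · dsimp only
    split_ifs <;> simp
  · have aux : ∀ x ∈ s, ∀ y ∈ s, x < y →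
        (if x < p then 0 else if x = p then 1 else 2) ≠
          (if y < p then 0 else if y = p then 1 else 2) := by
      intro x hx y hy hxy h
      refine key x hx y hy hxy fun ⟨h1, h2⟩ => ?_
      rw [if_neg (not_lt.2 h2)] at h
      rcases h1.lt_or_eq with h3 | h3
      · rw [if_pos h3] at h
        split_ifs at h
      · rw [if_neg (not_lt.2 h3.ge), if_pos h3, if_neg (by linarith [h3] : y ≠ p)] at h
        omega
    intro x hx y hy hxy
    rcases lt_trichotomy x y with h | h | h
    · exact absurd hxy (aux x hx y hy h)
    · exact h
    · exact absurd hxy.symm (aux y hy x hx h)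

/-- Each block of k steps along a common orbit of ε-balls merges at most three points; induction on
the number of blocks. -/
lemma card_le_of_forall_dist_lt (hf : IsUnimodalOn f a b c) {k : ℕ} {ε : ℝ}
    (h3 : ∀ (u w : ℝ) (s : Finset ℝ),
      (∀ x ∈ s, x ∈ Icc a b ∧ dist u x < ε ∧ f^[k] x = w) → s.card ≤ 3)
    (Z : Finset ℝ) (m : ℕ) (u : ℕ → ℝ) (s : Finset ℝ)
    (hs : ∀ x ∈ s, x ∈ Icc a b ∧ (∀ j < m, dist (u j) (f^[j * k] x) < ε) ∧ f^[m * k] x ∈ Z) :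
    s.card ≤ 3 ^ m * Z.card := by
  classical
  induction m generalizing u s with
  | zero =>
    simpa using Finset.card_le_card fun x hx => by simpa using (hs x hx).2.2
  | succ m ih =>
    have hshift : ∀ j x, f^[j * k] (f^[k] x) = f^[(j + 1) * k] x := fun j x => by
      rw [← Function.iterate_add_apply, Nat.succ_mul]
    rw [pow_succ', mul_assoc]
    refine (Finset.card_le_mul_card_image (f := f^[k]) s 3 fun z _ => ?_).trans
      (Nat.mul_le_mul_left 3 (ih (fun j => u (j + 1)) (s.image f^[k]) ?_))
    · refine h3 (u 0) z _ fun x hx => ?_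
      rw [Finset.mem_filter] at hx
      exact ⟨(hs x hx.1).1, by simpa using (hs x hx.1).2.1 0 (by omega), hx.2⟩
    · intro z hz
      obtain ⟨x, hx, rfl⟩ := Finset.mem_image.1 hz
      refine ⟨hf.mapsTo.iterate k (hs x hx).1, fun j hj => ?_, ?_⟩
      · rw [hshift]
        exact (hs x hx).2.1 (j + 1) (by omega)
      · rw [hshift]
        exact (hs x hx).2.2

/-- If the preimages of a finite set under `fⁿ` have at least `C rⁿ` elements, then the entropy is
at least `log r`. -/
theorem log_le_coverEntropy (hf : IsUnimodalOn f a b c) {r C : ℝ} (hr : 0 < r) (hC : 0 < C)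
    (Z : Finset ℝ)
    (hcount : ∀ n : ℕ, ∃ s : Finset ℝ, (∀ x ∈ s, x ∈ Icc a b ∧ f^[n] x ∈ Z) ∧
      C * r ^ n ≤ s.card) :
    (Real.log r : EReal) ≤ Dynamics.coverEntropy f (Icc a b) := by
  classical
  have hZ : 0 < Z.card := by
    obtain ⟨s, hs, hcard⟩ := hcount 0
    have : (0 : ℝ) < s.card := lt_of_lt_of_le (by positivity) hcard
    obtain ⟨x, hx⟩ := Finset.card_pos.1 (Nat.cast_pos.1 this)
    exact Finset.card_pos.2 ⟨_, (hs x hx).2⟩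
  have hZ' : (0 : ℝ) < Z.card := Nat.cast_pos.2 hZ
  refine EReal.ge_of_forall_gt_iff_ge.1 fun v hv => ?_
  have hv' : v < Real.log r := EReal.coe_lt_coe_iff.1 hv
  -- With this `k`, 3 e^{vk} < r^k: the factor 3 lost in each block costs less than the gap between
  -- v and log r.
  obtain ⟨k, hk⟩ := exists_nat_gt (Real.log 3 / (Real.log r - v))
  have hkpos : (0 : ℝ) < k := lt_of_le_of_lt (div_nonneg (Real.log_nonneg (by norm_num))
    (by linarith)) hk
  rw [div_lt_iff₀ (by linarith)] at hk
  obtain ⟨ε, hε, h3⟩ := hf.exists_ball_card_fiber_le k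
  refine le_trans ?_ (Dynamics.coverEntropyEntourage_le_coverEntropy f (Icc a b)
    (Metric.dist_mem_uniformity hε))
  have hbound : ∀ m : ℕ, ENNReal.ofReal (C / Z.card * (r ^ k / 3) ^ m) ≤
      (Dynamics.coverMincard f (Icc a b) {p : ℝ × ℝ | dist p.1 p.2 < ε} (m * k) : ENNReal) := by
    intro m
    rcases eq_top_or_lt_top (Dynamics.coverMincard f (Icc a b) {p : ℝ × ℝ | dist p.1 p.2 < ε}
      (m * k)) with htop | htop
    · rw [htop]; simp
    obtain ⟨t, ht, htc⟩ := (Dynamics.coverMincard_finite_iff _ _ _ _).1 htop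
    rw [← htc, ENat.toENNReal_coe, ← ENNReal.ofReal_natCast]
    refine ENNReal.ofReal_le_ofReal ?_
    obtain ⟨s, hs, hsc⟩ := hcount (m * k)
    have hcov : s ⊆ t.biUnion fun y => s.filter fun x =>
        ∀ j < m * k, dist (f^[j] y) (f^[j] x) < ε := by
      intro x hx
      obtain ⟨y, hy, hxy⟩ := ht (hs x hx).1
      refine Finset.mem_biUnion.2 ⟨y, hy, Finset.mem_filter.2 ⟨hx, fun j hj => ?_⟩⟩
      rw [dist_comm]
      exact Dynamics.mem_dynEntourage.1 hxy j hj
    have hcard : s.card ≤ t.card * (3 ^ m * Z.card) := by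
      refine (Finset.card_le_card hcov).trans (Finset.card_biUnion_le_card_mul _ _ _ fun y _ => ?_)
      refine hf.card_le_of_forall_dist_lt h3 Z m (fun j => f^[j * k] y) _ fun x hx => ?_
      rw [Finset.mem_filter] at hx
      exact ⟨(hs x hx.1).1, fun j hj => hx.2 _
        (Nat.mul_lt_mul_of_pos_right hj (Nat.cast_pos.1 hkpos)), (hs x hx.1).2⟩
    have hcard' : (s.card : ℝ) ≤ t.card * (3 ^ m * Z.card) := by exact_mod_cast hcard
    have := hsc.trans hcard'
    rw [div_pow, ← pow_mul, mul_comm k m, div_mul_div_comm, div_le_iff₀ (by positivity)]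
    linarith
  have hgrow : Tendsto (fun m : ℕ => C / Z.card * (r ^ k / 3 / Real.exp (v * k)) ^ m) atTop
      atTop := by
    refine Tendsto.const_mul_atTop (by positivity) (tendsto_pow_atTop_atTop_of_one_lt ?_)
    rw [lt_div_iff₀ (Real.exp_pos _), one_mul, lt_div_iff₀ (by norm_num),
      ← Real.exp_log (show (0 : ℝ) < 3 by norm_num), ← Real.exp_add,
      ← Real.exp_log (pow_pos hr k), Real.exp_lt_exp, Real.log_pow]
    linarith
  -- The entropy is a limsup, so the times m k suffice.
  refine Frequently.le_expGrowthSup ?_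
  have htends : Tendsto (fun m : ℕ => m * k) atTop atTop :=
    tendsto_id.atTop_mul_const' (Nat.cast_pos.1 hkpos)
  refine htends.frequently (Eventually.frequently ?_)
  filter_upwards [hgrow.eventually_ge_atTop 1] with m hmge
  refine le_trans ?_ (hbound m)
  have hexp : EReal.exp ((v : EReal) * ((m * k : ℕ) : EReal)) =
      ENNReal.ofReal (Real.exp (v * (m * k : ℕ))) := by
    rw [← EReal.exp_coe]
    norm_cast
  rw [hexp]
  refine ENNReal.ofReal_le_ofReal ?_
  rw [div_pow, ← mul_div_assoc, le_div_iff₀ (by positivity), one_mul, ← Real.exp_nat_mul] at hmge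
  refine le_trans (le_of_eq ?_) hmge
  congr 1
  push_cast
  ring

end IsUnimodalOn

/-! ### Kneading values along the critical orbit -/

/-- The turning point `c` is periodic with period `q + 1`, and the numbers `G 0, …, G q` satisfy the
recursion of the values at `t` of the kneading determinants of the points of its orbit. -/
structure IsKneadingSystem (f : ℝ → ℝ) (c : ℝ) (q : ℕ) (t : ℝ) (G : ℕ → ℝ) : Prop where
  ne : ∀ k < q, f^[k + 1] c ≠ c
  periodic : f^[q + 1] c = c
  left : ∀ k < q, f^[k + 1] c < c → G k = 1 + t * G (k + 1)
  right : ∀ k < q, c < f^[k + 1] c → G k = 1 - t * G (k + 1)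
  last : G q = 1
  succ_last : G (q + 1) = 0

namespace IsUnimodalOn

variable {f : ℝ → ℝ} {a b c : ℝ} {q : ℕ} {t : ℝ} {G : ℕ → ℝ}

lemma lt_turning (hf : IsUnimodalOn f a b c) {x : ℝ} (hx : x ∈ Icc a b) (hne : x ≠ c) :
    f x < f c := by
  rcases hne.lt_or_gt with h | h
  · exact hf.strictMonoOn ⟨hx.1, h.le⟩ ⟨hf.left_lt.le, le_rfl⟩ h
  · exact hf.strictAntiOn ⟨le_rfl, hf.lt_right.le⟩ ⟨h.le, hx.2⟩ h

lemma orbit_mem (hf : IsUnimodalOn f a b c) (k : ℕ) : f^[k] c ∈ Icc a b :=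
  hf.mapsTo.iterate k hf.mem

lemma orbit_lt (hf : IsUnimodalOn f a b c) (hG : IsKneadingSystem f c q t G) {k : ℕ} (hk : k < q) :
    f^[k + 2] c < f c := by
  rw [Function.iterate_succ_apply']
  exact hf.lt_turning (hf.orbit_mem _) (hG.ne k hk)

/-- Values exceed 1 to the left of c, are below 1 to the right and equal 1 at c, which settles
points not strictly on the same side. On a common side, f and the factor ±t have matching
monotonicity, so the comparison passes to the images. -/
lemma kneading_strictAnti (hf : IsUnimodalOn f a b c) (hG : IsKneadingSystem f c q t G) (ht : 0 < t)
    (hpos : ∀ k ≤ q, 0 < G k) {i j : ℕ} (hi : i ≤ q) (hj : j ≤ q)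
    (hij : f^[i + 1] c < f^[j + 1] c) : G j < G i := by
  -- The induction runs on `d`, a bound for the number of steps until the larger index reaches q,
  -- that is, until one of the two points is c.
  suffices h : ∀ d i j : ℕ, i ≤ q → j ≤ q → q ≤ max i j + d → f^[i + 1] c < f^[j + 1] c →
      G j < G i from h q i j hi hj (by omega) hij
  have hend : ∀ i j : ℕ, i ≤ q → j ≤ q → q ≤ max i j → f^[i + 1] c < f^[j + 1] c →
      G j < G i := by
    intro i j hi hj hd hij
    rcases hi.eq_or_lt with rfl | hi
    · rw [hG.periodic] at hij
      have hjq : j < i := lt_of_le_of_ne hj fun h => by rw [h, hG.periodic] at hij; exact hij.false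
      rw [hG.last, hG.right j hjq hij]
      nlinarith [hpos (j + 1) hjq]
    · obtain rfl : j = q := by omega
      rw [hG.periodic] at hij
      rw [hG.last, hG.left i hi hij]
      nlinarith [hpos (i + 1) hi]
  intro d
  induction d with
  | zero => exact hend
  | succ d ih =>
    intro i j hi hj hd hij
    by_cases hmax : q ≤ max i j
    · exact hend i j hi hj hmax hij
    have hi' : i < q := by omega
    have hj' : j < q := by omega
    have hPi := hf.orbit_mem (i + 1)
    have hPj := hf.orbit_mem (j + 1)
    rcases (hG.ne i hi').lt_or_gt with h1 | h1
    · rcases (hG.ne j hj').lt_or_gt with h2 | h2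
      · have h3 := hf.strictMonoOn ⟨hPi.1, h1.le⟩ ⟨hPj.1, h2.le⟩ hij
        rw [← Function.iterate_succ_apply' f, ← Function.iterate_succ_apply' f] at h3
        have h4 := ih (i + 1) (j + 1) hi' hj' (by omega) h3
        rw [hG.left i hi' h1, hG.left j hj' h2]
        nlinarith
      · rw [hG.left i hi' h1, hG.right j hj' h2]
        nlinarith [hpos (i + 1) hi', hpos (j + 1) hj']
    · have h2 := h1.trans hij
      have h3 := hf.strictAntiOn ⟨h1.le, hPi.2⟩ ⟨h2.le, hPj.2⟩ hij
      rw [← Function.iterate_succ_apply' f, ← Function.iterate_succ_apply' f] at h3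
      have h4 := ih (j + 1) (i + 1) hj' hi' (by omega) h3
      rw [hG.right i hi' h1, hG.right j hj' h2]
      nlinarith

/-- Up to the first positive zero of the kneading determinant, the determinants of the other points
of the critical orbit are positive. -/
lemma kneading_pos (hf : IsUnimodalOn f a b c) {G : ℝ → ℕ → ℝ} {τ : ℝ}
    (hG : ∀ t, IsKneadingSystem f c q t (G t)) (hcont : ∀ k, Continuous fun t => G t k)
    (hpos : ∀ t, 0 < t → t < τ → 0 < G t 0) {t : ℝ} (ht : 0 < t) (htτ : t < τ) {k : ℕ}
    (hk : k ≤ q) : 0 < G t k := by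
  by_contra! hneg
  -- `B` is the compact set of parameters where positivity fails. Before its least element s all
  -- values are positive, hence G 0 is the smallest of them, because f c is the largest orbit point.
  -- In the limit G 0 ≤ G m ≤ 0 at s, although G 0 > 0 there.
  set B : Set ℝ := Icc 0 t ∩ ⋃ k ∈ Iic q, {s | G s k ≤ 0} with hB
  have hBc : IsCompact B := isCompact_Icc.inter_right
    ((finite_Iic q).isClosed_biUnion fun k _ => isClosed_le (hcont k) continuous_const)
  have hmem : ∀ s, s ∈ B ↔ s ∈ Icc 0 t ∧ ∃ k ≤ q, G s k ≤ 0 := by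
    intro s; simp [hB]
  obtain ⟨s, hs, hmin⟩ := hBc.exists_isLeast ⟨t, (hmem t).2 ⟨⟨ht.le, le_rfl⟩, k, hk, hneg⟩⟩
  obtain ⟨⟨hs0, hst⟩, m, hm, hms⟩ := (hmem s).1 hs
  have hzero : ∀ k ≤ q, G 0 k = 1 := by
    intro k hk
    rcases hk.eq_or_lt with rfl | hk
    · exact (hG 0).last
    · rcases ((hG 0).ne k hk).lt_or_gt with h | h
      · simpa using (hG 0).left k hk h
      · simpa using (hG 0).right k hk h
  have hspos : 0 < s := by
    refine lt_of_le_of_ne hs0 fun h => ?_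
    rw [← h, hzero m hm] at hms
    linarith
  have hbefore : ∀ u ∈ Ioo 0 s, G u 0 ≤ G u m := by
    intro u hu
    have hupos : ∀ k ≤ q, 0 < G u k := by
      intro k hk
      by_contra! h
      exact absurd (hmin ((hmem u).2 ⟨⟨hu.1.le, hu.2.le.trans hst⟩, k, hk, h⟩)) (not_le.2 hu.2)
    rcases m with _ | m
    · exact le_rfl
    · exact (hf.kneading_strictAnti (hG u) hu.1 hupos hm (Nat.zero_le q)
        (hf.orbit_lt (hG u) hm)).le
  have hlim : G s 0 ≤ G s m := by
    refine le_of_tendsto_of_tendsto ((hcont 0).continuousWithinAt (s := Iio s))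
      ((hcont m).continuousWithinAt (s := Iio s)) ?_
    filter_upwards [Ioo_mem_nhdsLT hspos] with u hu using hbefore u hu
  linarith [hpos s hspos (hst.trans_lt htτ)]

end IsUnimodalOn

/-- The successor of an index along a cycle of length `q + 1`. -/
def cycleSucc (q k : ℕ) : ℕ := if k = q then 0 else k + 1

namespace IsKneadingSystem

variable {f : ℝ → ℝ} {c : ℝ} {q : ℕ} {t : ℝ} {G : ℕ → ℝ}

lemma cycleSucc_le {k : ℕ} (hk : k ≤ q) : cycleSucc q k ≤ q := by
  unfold cycleSucc
  split_ifs <;> omega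

lemma orbit_cycleSucc (hG : IsKneadingSystem f c q t G) (k : ℕ) :
    f^[cycleSucc q k + 1] c = f (f^[k + 1] c) := by
  unfold cycleSucc
  split_ifs with h
  · rw [h, hG.periodic]; simp
  · rw [← Function.iterate_succ_apply' f]

lemma eq_of_le (hG : IsKneadingSystem f c q t G) {k : ℕ} (hk : k ≤ q) (h : f^[k + 1] c ≤ c) :
    G k = 1 + t * G (k + 1) := by
  rcases hk.eq_or_lt with rfl | hk
  · rw [hG.last, hG.succ_last]; ring
  · exact hG.left k hk (lt_of_le_of_ne h (hG.ne k hk))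

lemma eq_of_ge (hG : IsKneadingSystem f c q t G) {k : ℕ} (hk : k ≤ q) (h : c ≤ f^[k + 1] c) :
    G k = 1 - t * G (k + 1) := by
  rcases hk.eq_or_lt with rfl | hk
  · rw [hG.last, hG.succ_last]; ring
  · exact hG.right k hk (lt_of_le_of_ne h (hG.ne k hk).symm)

/-- The recursion ends with G (q+1) = 0, whereas the orbit returns from c to f c, whose value is G
0. The defect G 0 has the sign that the upper count needs. -/
lemma succ_le_cycleSucc (hG : IsKneadingSystem f c q t G) (h0 : 0 ≤ G 0) (k : ℕ) :
    G (k + 1) ≤ G (cycleSucc q k) := by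
  unfold cycleSucc
  split_ifs with h
  · rw [h, hG.succ_last]; exact h0
  · exact le_rfl

lemma cycleSucc_eq_of_ne (h : f^[q + 1] c = c) {k : ℕ} (hk : f^[k + 1] c ≠ c) :
    cycleSucc q k = k + 1 := by
  unfold cycleSucc
  rw [if_neg]
  rintro rfl
  exact hk h

end IsKneadingSystem

/-! ### Counting preimages with kneading lengths, and the entropy formula -/

namespace IsUnimodalOn

variable {f : ℝ → ℝ} {a b c : ℝ} {q : ℕ} {t : ℝ} {G : ℕ → ℝ}

/-- Counting preimages between two points of the critical orbit. -/
lemma exists_card_le_of_kneading_pos (hf : IsUnimodalOn f a b c)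
    (hG : IsKneadingSystem f c q t G) (ht : 0 < t) (hpos : ∀ k ≤ q, 0 < G k) :
    ∃ K : ℝ, 0 ≤ K ∧ ∀ (n : ℕ) (y : ℝ) (i j : ℕ), i ≤ q → j ≤ q → f^[i + 1] c < f^[j + 1] c →
      ∀ s : Finset ℝ, (∀ x ∈ s, x ∈ Icc (f^[i + 1] c) (f^[j + 1] c) ∧ f^[n] x = y) →
        (s.card : ℝ) ≤ K * t⁻¹ ^ n * (G i - G j) := by
  classical
  -- `K` is large enough that K (G i - G j) ≥ 1 for every interval between orbit points, which
  -- settles n = 0.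
  set K : ℝ := ∑ i ∈ Finset.range (q + 1), ∑ j ∈ Finset.range (q + 1), |G i - G j|⁻¹ with hK
  have hK0 : 0 ≤ K := Finset.sum_nonneg fun i _ => Finset.sum_nonneg fun j _ => by positivity
  have hKge : ∀ i ≤ q, ∀ j ≤ q, |G i - G j|⁻¹ ≤ K := by
    intro i hi j hj
    refine le_trans ?_ (Finset.single_le_sum
      (f := fun i => ∑ j ∈ Finset.range (q + 1), |G i - G j|⁻¹)
      (fun i _ => Finset.sum_nonneg fun j _ => by positivity) (Finset.mem_range_succ_iff.2 hi))
    exact Finset.single_le_sum (f := fun j => |G i - G j|⁻¹) (fun j _ => by positivity)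
      (Finset.mem_range_succ_iff.2 hj)
  refine ⟨K, hK0, fun n => ?_⟩
  induction n with
  | zero =>
    intro y i j hi hj hij s hs
    have h1 : s.card ≤ 1 :=
      Finset.card_le_one.2 fun x hx x' hx' => (hs x hx).2.trans (hs x' hx').2.symm
    have h2 : 0 < G i - G j := sub_pos.2 (hf.kneading_strictAnti hG ht hpos hi hj hij)
    have h3 := hKge i hi j hj
    rw [abs_of_pos h2, inv_le_iff_one_le_mul₀ h2] at h3
    have h4 : (s.card : ℝ) ≤ 1 := by exact_mod_cast h1
    simpa using h4.trans h3
  | succ n ih =>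
    have hstep : ∀ (X : ℝ) {g g' : ℝ}, 0 ≤ X → t * g' ≤ g → X * g' ≤ X * t⁻¹ * g := by
      intro X g g' hX h
      rw [mul_assoc]
      gcongr
      rwa [← div_eq_inv_mul, le_div_iff₀ ht, mul_comm]
    -- On one side of c, f maps the interval injectively into the interval between the next orbit
    -- points. Only the end nearer to c can be c itself, and there the defect G 0 ≥ 0 enters.
    have hone : ∀ (y : ℝ) (i j : ℕ), i ≤ q → j ≤ q → f^[i + 1] c < f^[j + 1] c →
        (f^[j + 1] c ≤ c ∨ c ≤ f^[i + 1] c) → ∀ s : Finset ℝ,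
        (∀ x ∈ s, x ∈ Icc (f^[i + 1] c) (f^[j + 1] c) ∧ f^[n + 1] x = y) →
        (s.card : ℝ) ≤ K * t⁻¹ ^ (n + 1) * (G i - G j) := by
      intro y i j hi hj hij hside s hs
      have hPi := hf.orbit_mem (i + 1)
      have hPj := hf.orbit_mem (j + 1)
      rw [pow_succ, ← mul_assoc]
      have hX : 0 ≤ K * t⁻¹ ^ n := by positivity
      rcases hside with hside | hside
      · have hmono := hf.strictMonoOn.mono (Icc_subset_Icc hPi.1 hside)
        have hlt : f^[cycleSucc q i + 1] c < f^[cycleSucc q j + 1] c := by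
          rw [hG.orbit_cycleSucc, hG.orbit_cycleSucc]
          exact hmono ⟨le_rfl, hij.le⟩ ⟨hij.le, le_rfl⟩ hij
        have hcard := ih y _ _ (IsKneadingSystem.cycleSucc_le hi)
          (IsKneadingSystem.cycleSucc_le hj) hlt (s.image f) fun z hz => by
            obtain ⟨x, hx, rfl⟩ := Finset.mem_image.1 hz
            refine ⟨?_, (hs x hx).2⟩
            rw [hG.orbit_cycleSucc, hG.orbit_cycleSucc]
            have hxI := (hs x hx).1
            exact ⟨hmono.monotoneOn ⟨le_rfl, hij.le⟩ hxI hxI.1,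
              hmono.monotoneOn hxI ⟨hij.le, le_rfl⟩ hxI.2⟩
        rw [Finset.card_image_of_injOn (hmono.injOn.mono fun x hx => (hs x hx).1)] at hcard
        refine hcard.trans (hstep _ hX ?_)
        rw [hG.eq_of_le hi (hij.le.trans hside), hG.eq_of_le hj hside,
          IsKneadingSystem.cycleSucc_eq_of_ne hG.periodic (hij.trans_le hside).ne]
        nlinarith [hG.succ_le_cycleSucc (hpos 0 (Nat.zero_le q)).le j]
      · have hanti := hf.strictAntiOn.mono (Icc_subset_Icc hside hPj.2)
        have hlt : f^[cycleSucc q j + 1] c < f^[cycleSucc q i + 1] c := by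
          rw [hG.orbit_cycleSucc, hG.orbit_cycleSucc]
          exact hanti ⟨le_rfl, hij.le⟩ ⟨hij.le, le_rfl⟩ hij
        have hcard := ih y _ _ (IsKneadingSystem.cycleSucc_le hj)
          (IsKneadingSystem.cycleSucc_le hi) hlt (s.image f) fun z hz => by
            obtain ⟨x, hx, rfl⟩ := Finset.mem_image.1 hz
            refine ⟨?_, (hs x hx).2⟩
            rw [hG.orbit_cycleSucc, hG.orbit_cycleSucc]
            have hxI := (hs x hx).1
            exact ⟨hanti.antitoneOn hxI ⟨hij.le, le_rfl⟩ hxI.2,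
              hanti.antitoneOn ⟨le_rfl, hij.le⟩ hxI hxI.1⟩
        rw [Finset.card_image_of_injOn (hanti.injOn.mono fun x hx => (hs x hx).1)] at hcard
        refine hcard.trans (hstep _ hX ?_)
        rw [hG.eq_of_ge hi hside, hG.eq_of_ge hj (hside.trans hij.le),
          IsKneadingSystem.cycleSucc_eq_of_ne hG.periodic (hside.trans_lt hij).ne']
        nlinarith [hG.succ_le_cycleSucc (hpos 0 (Nat.zero_le q)).le i]
    intro y i j hi hj hij s hs
    by_cases hside : f^[j + 1] c ≤ c ∨ c ≤ f^[i + 1] c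
    · exact hone y i j hi hj hij hside s hs
    push Not at hside
    -- An interval around c is cut at c, the orbit point of index `q`; the lengths add up.
    have h1 := hone y i q hi le_rfl (by rw [hG.periodic]; exact hside.2) (Or.inl hG.periodic.le)
      (s.filter (· ≤ c)) fun x hx => by
        rw [Finset.mem_filter] at hx
        rw [hG.periodic]
        exact ⟨⟨(hs x hx.1).1.1, hx.2⟩, (hs x hx.1).2⟩
    have h2 := hone y q j le_rfl hj (by rw [hG.periodic]; exact hside.1) (Or.inr hG.periodic.ge)
      (s.filter (¬ · ≤ c)) fun x hx => by
        rw [Finset.mem_filter, not_le] at hx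
        rw [hG.periodic]
        exact ⟨⟨hx.2.le, (hs x hx.1).1.2⟩, (hs x hx.1).2⟩
    rw [← Finset.card_filter_add_card_filter_not (s := s) (p := (· ≤ c))]
    push_cast
    linarith

/-- Counting preimages in the whole interval. -/
lemma exists_card_preimage_le (hf : IsUnimodalOn f a b c)
    (hG : IsKneadingSystem f c q t G) (ht : 0 < t) (ht1 : t < 1) (hpos : ∀ k ≤ q, 0 < G k)
    (hq : 1 ≤ q) (h2 : f (f c) ≤ c) :
    ∃ K : ℝ, 0 ≤ K ∧ ∀ (n : ℕ) (y : ℝ) (s : Finset ℝ), (∀ x ∈ s, x ∈ Icc a b ∧ f^[n] x = y) →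
      (s.card : ℝ) ≤ K * t⁻¹ ^ n := by
  classical
  obtain ⟨K, hK, hcore⟩ := hf.exists_card_le_of_kneading_pos hG ht hpos
  have hr : 1 < t⁻¹ := (one_lt_inv₀ ht).2 ht1
  set r := t⁻¹
  have hlt : f^[1 + 1] c < f^[0 + 1] c := hf.orbit_lt hG hq
  have hle : ∀ x ∈ Icc a b, f x ≤ f c := fun x hx => by
    by_cases h : x = c
    · rw [h]
    · exact (hf.lt_turning hx h).le
  have hcmem : ∀ k, f^[k] c ∈ Icc a b := hf.orbit_mem
  set M := K * (G 1 - G 0) with hM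
  have hM0 : 0 ≤ M := mul_nonneg hK
    (sub_nonneg.2 (hf.kneading_strictAnti hG ht hpos hq (Nat.zero_le q) hlt).le)
  have hmid : ∀ (n : ℕ) (y : ℝ) (s : Finset ℝ),
      (∀ x ∈ s, x ∈ Icc (f (f c)) (f c) ∧ f^[n] x = y) → (s.card : ℝ) ≤ M * r ^ n := by
    intro n y s hs
    refine (hcore n y 1 0 hq (Nat.zero_le q) hlt s hs).trans_eq ?_
    rw [hM]; ring
  -- One step takes [a, f²c] injectively into [a, fc]. The part in [f²c, fc] costs M rⁿ and the rest
  -- is of the same kind, so a geometric sum results.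
  have hleft : ∀ (n : ℕ) (y : ℝ) (s : Finset ℝ),
      (∀ x ∈ s, x ∈ Icc a (f (f c)) ∧ f^[n] x = y) → (s.card : ℝ) ≤ (1 + M / (r - 1)) * r ^ n := by
    intro n
    induction n with
    | zero =>
      intro y s hs
      have h1 : s.card ≤ 1 :=
        Finset.card_le_one.2 fun x hx x' hx' => (hs x hx).2.trans (hs x' hx').2.symm
      have h4 : (s.card : ℝ) ≤ 1 := by exact_mod_cast h1
      have : 0 ≤ M / (r - 1) := div_nonneg hM0 (by linarith)
      simp only [pow_zero, mul_one]
      linarith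
    | succ n ih =>
      intro y s hs
      have hsub : ↑s ⊆ Icc a c := fun x hx => ⟨(hs x hx).1.1, (hs x hx).1.2.trans h2⟩
      have hinj : InjOn f s := hf.strictMonoOn.injOn.mono hsub
      rw [← Finset.card_image_of_injOn hinj,
        ← Finset.card_filter_add_card_filter_not (s := s.image f) (p := (· ≤ f (f c)))]
      have hsI : ∀ x ∈ s, x ∈ Icc a b := fun x hx =>
        ⟨(hs x hx).1.1, (hs x hx).1.2.trans (h2.trans hf.lt_right.le)⟩
      have h1 := ih y ((s.image f).filter (· ≤ f (f c))) fun z hz => by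
        rw [Finset.mem_filter, Finset.mem_image] at hz
        obtain ⟨⟨x, hx, rfl⟩, hz⟩ := hz
        exact ⟨⟨(hf.mapsTo (hsI x hx)).1, hz⟩, (hs x hx).2⟩
      have h3 := hmid n y ((s.image f).filter (¬ · ≤ f (f c))) fun z hz => by
        rw [Finset.mem_filter, Finset.mem_image, not_le] at hz
        obtain ⟨⟨x, hx, rfl⟩, hz⟩ := hz
        exact ⟨⟨hz.le, hle x (hsI x hx)⟩, (hs x hx).2⟩
      push_cast
      have h4 : (1 + M / (r - 1)) * r ^ (n + 1) =
          (1 + M / (r - 1)) * r ^ n + (M + (r - 1)) * r ^ n := by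
        have : r - 1 ≠ 0 := by linarith
        field_simp
        ring
      have h5 : 0 ≤ (r - 1) * r ^ n := mul_nonneg (by linarith) (by positivity)
      rw [h4]
      linarith
  have hK' : 0 ≤ M / (r - 1) := div_nonneg hM0 (by linarith)
  have hright : ∀ (n : ℕ) (y : ℝ) (s : Finset ℝ),
      (∀ x ∈ s, x ∈ Icc (f c) b ∧ f^[n] x = y) → (s.card : ℝ) ≤ (1 + M / (r - 1)) * r ^ n := by
    intro n y s hs
    rcases n with _ | n
    · have h1 : s.card ≤ 1 :=
        Finset.card_le_one.2 fun x hx x' hx' => (hs x hx).2.trans (hs x' hx').2.symm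
      have h4 : (s.card : ℝ) ≤ 1 := by exact_mod_cast h1
      simp only [pow_zero, mul_one]
      linarith
    -- Otherwise the whole forward orbit of c would stay below c and never return. Consequently [fc,
    -- b] lies on the decreasing branch and enters [a, f²c] in one step.
    · have hcfc : c ≤ f c := by
        by_contra! h
        have h3 : ∀ k, f^[k + 1] c < c := by
          intro k
          induction k with
          | zero => simpa using h
          | succ k ih =>
            rw [Function.iterate_succ_apply']
            exact (hle _ (hcmem _)).trans_lt h
        exact absurd hG.periodic (h3 q).ne
      have hsI : ∀ x ∈ s, x ∈ Icc c b := fun x hx =>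
        ⟨hcfc.trans (hs x hx).1.1, (hs x hx).1.2⟩
      have hinj : InjOn f s := hf.strictAntiOn.injOn.mono fun x hx => hsI x hx
      rw [← Finset.card_image_of_injOn hinj]
      refine (hleft n y (s.image f) fun z hz => ?_).trans ?_
      · obtain ⟨x, hx, rfl⟩ := Finset.mem_image.1 hz
        have hfc := hcmem 1
        exact ⟨⟨(hf.mapsTo ⟨hf.left_lt.le.trans (hsI x hx).1, (hsI x hx).2⟩).1,
          hf.strictAntiOn.antitoneOn ⟨hcfc, hfc.2⟩ (hsI x hx) (hs x hx).1.1⟩, (hs x hx).2⟩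
      · have : r ^ n ≤ r ^ (n + 1) := pow_le_pow_right₀ hr.le (Nat.le_succ n)
        gcongr
  refine ⟨(1 + M / (r - 1)) + M + (1 + M / (r - 1)), by positivity, fun n y s hs => ?_⟩
  have h1 := hleft n y (s.filter (· ≤ f (f c))) fun x hx => by
    rw [Finset.mem_filter] at hx
    exact ⟨⟨(hs x hx.1).1.1, hx.2⟩, (hs x hx.1).2⟩
  have h3 := hmid n y ((s.filter (¬ · ≤ f (f c))).filter (· ≤ f c)) fun x hx => by
    rw [Finset.mem_filter, Finset.mem_filter, not_le] at hx
    exact ⟨⟨hx.1.2.le, hx.2⟩, (hs x hx.1.1).2⟩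
  have h4 := hright n y ((s.filter (¬ · ≤ f (f c))).filter (¬ · ≤ f c)) fun x hx => by
    rw [Finset.mem_filter, Finset.mem_filter, not_le, not_le] at hx
    exact ⟨⟨hx.2.le, (hs x hx.1.1).1.2⟩, (hs x hx.1.1).2⟩
  rw [← Finset.card_filter_add_card_filter_not (s := s) (p := (· ≤ f (f c))),
    ← Finset.card_filter_add_card_filter_not (s := s.filter (¬ · ≤ f (f c))) (p := (· ≤ f c))]
  push_cast
  linarith

/-- At a zero of the kneading determinant, preimages between two points of the critical orbit
grow in number at least like `t⁻ⁿ`. -/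
lemma exists_le_card_of_kneading_zero (hf : IsUnimodalOn f a b c)
    (hG : IsKneadingSystem f c q t G) (ht : 0 < t) (h0 : G 0 = 0) :
    ∃ (C : ℝ) (Z : Finset ℝ), 0 < C ∧ ∀ (n i j : ℕ), i ≤ q → j ≤ q →
      f^[i + 1] c < f^[j + 1] c → ∃ s : Finset ℝ,
        (∀ x ∈ s, x ∈ Ioo (f^[i + 1] c) (f^[j + 1] c) ∧ f^[n] x ∈ Z) ∧
          C * t⁻¹ ^ n * (G i - G j) ≤ s.card := by
  classical
  set K : ℝ := 1 + ∑ i ∈ Finset.range (q + 1), ∑ j ∈ Finset.range (q + 1), |G i - G j| with hK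
  have hK0 : 0 < K := add_pos_of_pos_of_nonneg one_pos
    (Finset.sum_nonneg fun i _ => Finset.sum_nonneg fun j _ => by positivity)
  have hKge : ∀ i ≤ q, ∀ j ≤ q, G i - G j ≤ K := by
    intro i hi j hj
    have h1 := Finset.single_le_sum
      (f := fun i => ∑ j ∈ Finset.range (q + 1), |G i - G j|)
      (fun i _ => Finset.sum_nonneg fun j _ => by positivity) (Finset.mem_range_succ_iff.2 hi)
    have h2 := Finset.single_le_sum (f := fun j => |G i - G j|) (fun j _ => by positivity)
      (Finset.mem_range_succ_iff.2 hj)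
    have h3 := le_abs_self (G i - G j)
    linarith
  -- The targets are the midpoints of pairs of orbit points, one inside every interval. Open
  -- intervals keep the two pieces disjoint when an interval is cut at c.
  refine ⟨K⁻¹, (Finset.range (q + 1) ×ˢ Finset.range (q + 1)).image
    (fun p => (f^[p.1 + 1] c + f^[p.2 + 1] c) / 2), inv_pos.2 hK0, fun n => ?_⟩
  set Z := (Finset.range (q + 1) ×ˢ Finset.range (q + 1)).image
    (fun p => (f^[p.1 + 1] c + f^[p.2 + 1] c) / 2) with hZ
  induction n with
  | zero =>
    intro i j hi hj hij
    refine ⟨{(f^[i + 1] c + f^[j + 1] c) / 2}, fun x hx => ?_, ?_⟩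
    · rw [Finset.mem_singleton] at hx
      refine ⟨⟨by rw [hx]; linarith, by rw [hx]; linarith⟩, ?_⟩
      rw [hx, Function.iterate_zero, id]
      exact Finset.mem_image.2 ⟨(i, j), by simp; omega, rfl⟩
    · rw [Finset.card_singleton, pow_zero, mul_one, Nat.cast_one, ← div_eq_inv_mul,
        div_le_one hK0]
      exact hKge i hi j hj
  | succ n ih =>
    -- Since G 0 = 0, there is no defect at the return from c to f c, and lengths scale exactly.
    have hcs : ∀ k, G (cycleSucc q k) = G (k + 1) := by
      intro k
      unfold cycleSucc
      split_ifs with h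
      · rw [h, hG.succ_last, h0]
      · rfl
    have hone : ∀ (i j : ℕ), i ≤ q → j ≤ q → f^[i + 1] c < f^[j + 1] c →
        (f^[j + 1] c ≤ c ∨ c ≤ f^[i + 1] c) → ∃ s : Finset ℝ,
        (∀ x ∈ s, x ∈ Ioo (f^[i + 1] c) (f^[j + 1] c) ∧ f^[n + 1] x ∈ Z) ∧
          K⁻¹ * t⁻¹ ^ (n + 1) * (G i - G j) ≤ s.card := by
      intro i j hi hj hij hside
      have hPi := hf.orbit_mem (i + 1)
      have hPj := hf.orbit_mem (j + 1)
      have hcont : ContinuousOn f (Icc (f^[i + 1] c) (f^[j + 1] c)) :=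
        hf.continuousOn.mono (Icc_subset_Icc hPi.1 hPj.2)
      obtain ⟨s, hs, hcard⟩ : ∃ s : Finset ℝ,
          (∀ x ∈ s, x ∈ f '' Ioo (f^[i + 1] c) (f^[j + 1] c) ∧ f^[n] x ∈ Z) ∧
            K⁻¹ * t⁻¹ ^ (n + 1) * (G i - G j) ≤ s.card := by
        rcases hside with hside | hside
        · have hlt := hf.strictMonoOn ⟨hPi.1, hij.le.trans hside⟩ ⟨hPj.1, hside⟩ hij
          rw [← hG.orbit_cycleSucc, ← hG.orbit_cycleSucc] at hlt
          obtain ⟨s, hs, hcard⟩ := ih _ _ (IsKneadingSystem.cycleSucc_le hi)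
            (IsKneadingSystem.cycleSucc_le hj) hlt
          refine ⟨s, fun x hx => ⟨intermediate_value_Ioo hij.le hcont ?_, (hs x hx).2⟩, ?_⟩
          · simpa only [hG.orbit_cycleSucc] using (hs x hx).1
          · refine le_trans (le_of_eq ?_) hcard
            rw [hcs, hcs, hG.eq_of_le hi (hij.le.trans hside), hG.eq_of_le hj hside]
            linear_combination K⁻¹ * t⁻¹ ^ n * (G (i + 1) - G (j + 1)) * inv_mul_cancel₀ ht.ne'
        · have hlt := hf.strictAntiOn ⟨hside, hPi.2⟩ ⟨hside.trans hij.le, hPj.2⟩ hij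
          rw [← hG.orbit_cycleSucc, ← hG.orbit_cycleSucc] at hlt
          obtain ⟨s, hs, hcard⟩ := ih _ _ (IsKneadingSystem.cycleSucc_le hj)
            (IsKneadingSystem.cycleSucc_le hi) hlt
          refine ⟨s, fun x hx => ⟨intermediate_value_Ioo' hij.le hcont ?_, (hs x hx).2⟩, ?_⟩
          · simpa only [hG.orbit_cycleSucc] using (hs x hx).1
          · refine le_trans (le_of_eq ?_) hcard
            rw [hcs, hcs, hG.eq_of_ge hi hside, hG.eq_of_ge hj (hside.trans hij.le)]
            linear_combination K⁻¹ * t⁻¹ ^ n * (G (j + 1) - G (i + 1)) * inv_mul_cancel₀ ht.ne'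
      obtain ⟨s', hs', rfl⟩ := Finset.subset_set_image_iff.1 fun x hx => (hs x hx).1
      refine ⟨s', fun x hx => ⟨hs' hx, (hs (f x) (Finset.mem_image_of_mem f hx)).2⟩, ?_⟩
      exact hcard.trans (Nat.cast_le.2 Finset.card_image_le)
    intro i j hi hj hij
    by_cases hside : f^[j + 1] c ≤ c ∨ c ≤ f^[i + 1] c
    · exact hone i j hi hj hij hside
    push Not at hside
    obtain ⟨s₁, hs₁, hc₁⟩ := hone i q hi le_rfl (by rw [hG.periodic]; exact hside.2)
      (Or.inl hG.periodic.le)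
    obtain ⟨s₂, hs₂, hc₂⟩ := hone q j le_rfl hj (by rw [hG.periodic]; exact hside.1)
      (Or.inr hG.periodic.ge)
    rw [hG.periodic] at hs₁ hs₂
    refine ⟨s₁ ∪ s₂, fun x hx => ?_, ?_⟩
    · rcases Finset.mem_union.1 hx with hx | hx
      · exact ⟨⟨(hs₁ x hx).1.1, (hs₁ x hx).1.2.trans hside.1⟩, (hs₁ x hx).2⟩
      · exact ⟨⟨hside.2.trans (hs₂ x hx).1.1, (hs₂ x hx).1.2⟩, (hs₂ x hx).2⟩
    · rw [Finset.card_union_of_disjoint (Finset.disjoint_left.2 fun x h1 h2 =>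
        lt_asymm (hs₁ x h1).1.2 (hs₂ x h2).1.1)]
      push_cast
      linarith

/-- The entropy of a unimodal map with periodic turning point is `-log τ`, where `τ` is the
smallest positive zero of its kneading determinant. -/
theorem coverEntropy_eq_neg_log (hf : IsUnimodalOn f a b c) {G : ℝ → ℕ → ℝ} {τ : ℝ}
    (hG : ∀ t, IsKneadingSystem f c q t (G t)) (hcont : ∀ k, Continuous fun t => G t k)
    (hq : 1 ≤ q) (h2 : f (f c) ≤ c) (hτ : 0 < τ) (hτ1 : τ ≤ 1)
    (hpos : ∀ t, 0 < t → t < τ → 0 < G t 0) (h0 : G τ 0 = 0) :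
    Dynamics.coverEntropy f (Icc a b) = ((-Real.log τ : ℝ) : EReal) := by
  have hlog : 0 ≤ -Real.log τ := neg_nonneg.2 (Real.log_nonpos hτ.le hτ1)
  refine le_antisymm (EReal.le_of_forall_lt_iff_le.1 fun v hv => ?_) ?_
  · have hv' : -Real.log τ < v := EReal.coe_lt_coe_iff.1 hv
    -- The upper count is applied at t = e^{-v}, strictly below τ, where all kneading values are
    -- positive.
    have htτ : Real.exp (-v) < τ := by
      rw [← Real.lt_log_iff_exp_lt hτ]
      linarith
    have ht : 0 < Real.exp (-v) := Real.exp_pos _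
    obtain ⟨K, hK, h⟩ := hf.exists_card_preimage_le (hG _) ht (htτ.trans_le hτ1)
      (fun k hk => hf.kneading_pos hG hcont hpos ht htτ hk) hq h2
    have hexp : (Real.exp (-v))⁻¹ = Real.exp v := by rw [Real.exp_neg, inv_inv]
    rw [hexp] at h
    have := coverEntropy_le_log_of_card_preimage_le hf.continuousOn hf.mapsTo
      (Real.one_lt_exp_iff.2 (by linarith)) hK h
    rwa [Real.log_exp] at this
  · obtain ⟨C, Z, hC, h⟩ := hf.exists_le_card_of_kneading_zero (hG τ) hτ h0
    rw [← Real.log_inv]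
    refine hf.log_le_coverEntropy (inv_pos.2 hτ) hC Z fun n => ?_
    -- The interval from c to f c has length G q - G 0 = 1 at τ.
    have hlt : f^[q + 1] c < f^[0 + 1] c := by
      obtain ⟨k, rfl⟩ := Nat.exists_eq_add_of_le' hq
      exact hf.orbit_lt (hG τ) (Nat.lt_succ_self k)
    obtain ⟨s, hs, hcard⟩ := h n q 0 le_rfl (Nat.zero_le q) hlt
    refine ⟨s, fun x hx => ⟨⟨?_, ?_⟩, (hs x hx).2⟩, ?_⟩
    · exact (hf.orbit_mem (q + 1)).1.trans (hs x hx).1.1.le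
    · exact (hs x hx).1.2.le.trans (hf.orbit_mem (0 + 1)).2
    · rwa [(hG τ).last, h0, sub_zero, mul_one] at hcard

end IsUnimodalOn

/-! ### From superstable words to kneading values -/

lemma letterAt_eq_L_iff {c x : ℝ} : letterAt c x = Letter.L ↔ x < c := by
  unfold letterAt; split_ifs <;> simp_all

lemma letterAt_eq_C_iff {c x : ℝ} : letterAt c x = Letter.C ↔ x = c := by
  unfold letterAt
  split_ifs with h h'
  · simp [h.ne]
  · simp [h']
  · simp [h']

lemma letterAt_eq_R_iff {c x : ℝ} : letterAt c x = Letter.R ↔ c < x := by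
  unfold letterAt
  split_ifs with h h'
  · simp [h.le]
  · simp [h'.le]
  · simpa using lt_of_le_of_ne (not_lt.1 h) (Ne.symm h')

/-- The itinerary of f^{k+1}(c) begins with the suffix of the word from letter k, and the recursion
is the Horner form of `signPoly`. -/
lemma HasSuperstableWord.isKneadingSystem {f : ℝ → ℝ} {c : ℝ} {w : List Letter}
    (h : HasSuperstableWord f c w) (hC : Letter.C ∉ w) (hw : w ≠ []) (t : ℝ) :
    IsKneadingSystem f c (w.length - 1) t fun k => (signPoly (w.drop k)).eval t := by
  have hlen : 0 < w.length := List.length_pos_of_ne_nil hw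
  have hlet : ∀ k, k < w.length - 1 → w[k]? = some (letterAt c (f^[k + 1] c)) := fun k hk => by
    rw [h k]; exact periodicSeq_capC_of_lt w k (by omega)
  have hdrop : ∀ k, k < w.length - 1 → (signPoly (w.drop k)).eval t =
      1 + letterSign (letterAt c (f^[k + 1] c)) * t * (signPoly (w.drop (k + 1))).eval t := by
    intro k hk
    have hk' : k < w.length := by omega
    have h1 := hlet k hk
    rw [List.getElem?_eq_getElem hk', Option.some_inj] at h1
    rw [List.drop_eq_getElem_cons hk', h1, signPoly]
    simp
  refine ⟨fun k hk he => ?_, ?_, fun k hk hlt => ?_, fun k hk hlt => ?_, ?_, ?_⟩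
  · have h1 := hlet k hk
    rw [letterAt_eq_C_iff.2 he] at h1
    exact hC (List.mem_of_getElem? h1)
  · rw [← letterAt_eq_C_iff, h, periodicSeq_capC_last w hw]
  · rw [hdrop k hk, letterAt_eq_L_iff.2 hlt]
    simp [letterSign]
  · rw [hdrop k hk, letterAt_eq_R_iff.2 hlt]
    simp [letterSign]
    ring
  · rw [List.drop_eq_getElem_cons (by omega), Nat.sub_add_cancel hlen]
    simp [signPoly]
  · rw [Nat.sub_add_cancel hlen]
    simp [signPoly]

lemma HasSuperstableWord.iterate_two_le {f : ℝ → ℝ} {c : ℝ} {w : List Letter} {l : Letter}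
    (h : HasSuperstableWord f c (l :: Letter.L :: w)) : f (f c) ≤ c := by
  have h1 := h 1
  rcases w with _ | ⟨m, w⟩
  · exact (letterAt_eq_C_iff.1 h1).le
  · have h2 := periodicSeq_capC_of_lt (l :: Letter.L :: m :: w) 1 (by simp)
    rw [← h1] at h2
    simp only [List.getElem?_cons_succ, List.getElem?_cons_zero, Option.some_inj] at h2
    exact (letterAt_eq_L_iff.1 h2.symm).le

/-- The entropy of a unimodal map with superstable word `w|_C`, where `w` starts with `RL`. -/
theorem IsUnimodalOn.entropyOn_eq_neg_log {f : ℝ → ℝ} {a b c τ : ℝ} {w : List Letter}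
    (hf : IsUnimodalOn f a b c) {l : Letter} (h : HasSuperstableWord f c (l :: Letter.L :: w))
    (hC : Letter.C ∉ l :: Letter.L :: w) (hτ1 : τ ≤ 1)
    (hτ : IsLeast (positiveZeros (kneadingDet (l :: Letter.L :: w))) τ) :
    entropyOn f a b = ((-Real.log τ : ℝ) : EReal) := by
  rw [kneadingDet_eq_signPoly _ hC] at hτ
  -- The value at 0 is 1, so a nonpositive value before τ would produce an earlier zero.
  have hp : ∀ t, 0 < t → t < τ → 0 < (signPoly (l :: Letter.L :: w)).eval t := by
    intro t ht htτ
    by_contra! hneg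
    have h0 : (0 : ℝ) ≤ (signPoly (l :: Letter.L :: w)).eval 0 := by simp [signPoly]
    obtain ⟨s, hs, hs0⟩ := intermediate_value_Icc' ht.le
      (signPoly (l :: Letter.L :: w)).continuousOn (show (0 : ℝ) ∈ Icc _ _ from ⟨hneg, h0⟩)
    have hs1 : 0 < s := by
      refine lt_of_le_of_ne hs.1 ?_
      rintro rfl
      simp [signPoly] at hs0
    exact absurd (hτ.2 ⟨hs1, hs0⟩) (not_le.2 (hs.2.trans_lt htτ))
  exact hf.coverEntropy_eq_neg_log (fun t => h.isKneadingSystem hC (by simp) t)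
    (fun k => (signPoly _).continuous) (by simp) h.iterate_two_le hτ.1.1 hτ1 hp hτ.1.2

/-! ### Bounds for sign polynomials and the smallest zeros of the Pell determinants -/

lemma exists_pellWord_eq_cons (n : ℕ) (hn : 2 ≤ n) :
    ∃ s, pellWord n = Letter.R :: Letter.L :: s := by
  induction n, hn using Nat.le_induction with
  | base => exact ⟨[], by simp [pellWord, pellSubst, pellSubstLetter]⟩
  | succ n hn ih =>
    obtain ⟨s, hs⟩ := ih
    obtain ⟨m, rfl⟩ := Nat.exists_eq_add_of_le' hn
    rw [show m + 2 + 1 = (m + 1) + 2 from rfl, pellWord_concat (m + 1) (by omega), hs]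
    exact ⟨_, rfl⟩

lemma abs_letterSign_le (l : Letter) : |letterSign l| ≤ 1 := by
  cases l <;> simp [letterSign]

lemma eval_signPoly_cons (l : Letter) (s : List Letter) (x : ℝ) :
    (signPoly (l :: s)).eval x = 1 + letterSign l * (x * (signPoly s).eval x) := by
  simp [signPoly, mul_assoc]

lemma derivative_signPoly_cons (l : Letter) (s : List Letter) :
    derivative (signPoly (l :: s)) =
      C (letterSign l) * (signPoly s + X * derivative (signPoly s)) := by
  rw [signPoly, mul_assoc, derivative_add, derivative_one, zero_add, derivative_C_mul,
    derivative_mul, derivative_X, one_mul]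

lemma abs_letterSign_mul_le (l : Letter) {y B : ℝ} (h : |y| ≤ B) : |letterSign l * y| ≤ B := by
  rw [abs_mul]
  exact (mul_le_of_le_one_left (abs_nonneg y) (abs_letterSign_le l)).trans h

lemma abs_mul_le_two_thirds {x y B : ℝ} (hx : x ∈ Icc (0 : ℝ) (2 / 3)) (h : |y| ≤ B) :
    |x * y| ≤ 2 / 3 * B := by
  rw [abs_mul, abs_of_nonneg hx.1]
  exact mul_le_mul hx.2 h (abs_nonneg y) (by norm_num)

/-- The constant solves B = 1 + (2/3) B, so the bound does not depend on the length of the word. -/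
lemma abs_eval_signPoly_le {x : ℝ} (hx : x ∈ Icc (0 : ℝ) (2 / 3)) (s : List Letter) :
    |(signPoly s).eval x| ≤ 3 := by
  induction s with
  | nil => simp [signPoly]
  | cons l s ih =>
    rw [eval_signPoly_cons]
    have h := abs_letterSign_mul_le l (abs_mul_le_two_thirds hx ih)
    refine (abs_add_le _ _).trans ?_
    rw [abs_one]
    linarith

/-- Here B = 3 + (2/3) B. -/
lemma abs_eval_derivative_signPoly_le {x : ℝ} (hx : x ∈ Icc (0 : ℝ) (2 / 3)) (s : List Letter) :
    |(derivative (signPoly s)).eval x| ≤ 9 := by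
  induction s with
  | nil => simp [signPoly]
  | cons l s ih =>
    rw [derivative_signPoly_cons, eval_mul, eval_C, eval_add, eval_mul, eval_X]
    refine abs_letterSign_mul_le l ((abs_add_le _ _).trans ?_)
    have h := abs_mul_le_two_thirds hx ih
    have := abs_eval_signPoly_le hx s
    linarith

/-- Here B = 9 + 9 + (2/3) B. -/
lemma abs_eval_derivative_derivative_signPoly_le {x : ℝ} (hx : x ∈ Icc (0 : ℝ) (2 / 3))
    (s : List Letter) : |(derivative (derivative (signPoly s))).eval x| ≤ 54 := by
  induction s with
  | nil => simp [signPoly]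
  | cons l s ih =>
    rw [derivative_signPoly_cons, derivative_C_mul, derivative_add, derivative_mul, derivative_X,
      one_mul, eval_mul, eval_C, eval_add, eval_add, eval_mul, eval_X]
    refine abs_letterSign_mul_le l ((abs_add_le _ _).trans ?_)
    have h1 := abs_add_le ((derivative (signPoly s)).eval x)
      (x * (derivative (derivative (signPoly s))).eval x)
    have h := abs_mul_le_two_thirds hx ih
    have := abs_eval_derivative_signPoly_le hx s
    linarith

lemma eval_signPoly_mem_Icc {x : ℝ} (hx : x ∈ Icc (0 : ℝ) (1 / 2)) (s : List Letter) :
    (signPoly s).eval x ∈ Icc (0 : ℝ) 2 := by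
  induction s with
  | nil => simp [signPoly]
  | cons l s ih =>
    have h : |x * (signPoly s).eval x| ≤ 1 := by
      rw [abs_of_nonneg (mul_nonneg hx.1 ih.1)]
      nlinarith [hx.1, hx.2, ih.1, ih.2]
    rw [eval_signPoly_cons]
    have h1 := abs_le.1 (abs_letterSign_mul_le l h)
    constructor <;> linarith [h1.1, h1.2]

lemma eval_signPoly_pos {x : ℝ} (hx : x ∈ Ico (0 : ℝ) (1 / 2)) {s : List Letter} (hs : s ≠ []) :
    0 < (signPoly s).eval x := by
  obtain ⟨l, s, rfl⟩ := List.exists_cons_of_ne_nil hs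
  have ih := eval_signPoly_mem_Icc ⟨hx.1, hx.2.le⟩ s
  have h : |x * (signPoly s).eval x| ≤ 2 * x := by
    rw [abs_of_nonneg (mul_nonneg hx.1 ih.1)]
    nlinarith [hx.1, ih.2]
  rw [eval_signPoly_cons]
  linarith [(abs_le.1 (abs_letterSign_mul_le l h)).1, hx.2]

lemma exists_isLeast_positiveZeros {p : ℝ[X]} {y : ℝ} (h0 : 0 < p.eval 0) (hy : 0 < y)
    (hpy : p.eval y < 0) : ∃ m < y, IsLeast (positiveZeros p) m := by
  obtain ⟨z, hz, hz0⟩ := intermediate_value_Icc' hy.le p.continuousOn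
    (show (0 : ℝ) ∈ Icc _ _ from ⟨hpy.le, h0.le⟩)
  have hcomp : IsCompact (Icc 0 y ∩ {x | p.eval x = 0}) :=
    isCompact_Icc.inter_right (isClosed_eq p.continuous continuous_const)
  obtain ⟨m, ⟨hm, hm0⟩, hmin⟩ := hcomp.exists_isLeast ⟨z, hz, hz0⟩
  change p.eval m = 0 at hm0
  have hm1 : 0 < m := lt_of_le_of_ne hm.1 fun h => by rw [← h] at hm0; exact h0.ne' hm0
  refine ⟨m, lt_of_le_of_ne hm.2 fun h => by rw [h] at hm0; exact hpy.ne hm0, ⟨hm1, hm0⟩, ?_⟩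
  intro x hx
  by_cases hxy : x ≤ y
  · exact hmin ⟨⟨hx.1.le, hxy⟩, hx.2⟩
  · exact hm.2.trans (not_le.1 hxy).le

lemma eval_pos_of_lt_isLeast {p : ℝ[X]} {m x : ℝ} (h0 : 0 < p.eval 0)
    (hm : IsLeast (positiveZeros p) m) (hx : 0 < x) (hxm : x < m) : 0 < p.eval x := by
  by_contra! h
  rcases h.lt_or_eq with h | h
  · obtain ⟨z, hz, hzl⟩ := exists_isLeast_positiveZeros h0 hx h
    exact absurd (hm.2 hzl.1) (not_le.2 (hz.trans hxm))
  · exact absurd (hm.2 ⟨hx, h⟩) (not_le.2 hxm)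

/-- The kneading determinant of the `n`-th Pell word. -/
noncomputable abbrev pellDet (n : ℕ) : ℝ[X] := kneadingDet (pellWord n)

lemma pellDet_eq (n : ℕ) : pellDet n = signPoly (pellWord n) :=
  kneadingDet_eq_signPoly _ (C_notMem_pellWord n)

lemma pellDet_one : pellDet 1 = 1 := by
  simp [pellDet_eq, pellWord, signPoly]

lemma pellDet_two : pellDet 2 = 1 - X := by
  simp [pellDet_eq, pellWord, signPoly, pellSubst, pellSubstLetter, letterSign]
  ring

lemma pellDet_three : pellDet 3 = 1 - X - X ^ 2 + X ^ 3 - X ^ 4 := by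
  rw [pellDet, kneadingDet_pellWord_succ 2 le_rfl]
  change pellDet 2 - X ^ pellNumber 2 * pellDet 1 + X ^ (pellNumber 2 + pellNumber 1) * pellDet 2 = _
  rw [pellDet_one, pellDet_two]
  simp only [pellNumber]
  ring

lemma pellDet_four : pellDet 4 = 1 - X - X ^ 2 + X ^ 3 - X ^ 4 - X ^ 5 + X ^ 6 + X ^ 7 - X ^ 8
    - X ^ 9 + X ^ 10 - X ^ 11 := by
  rw [pellDet, kneadingDet_pellWord_succ 3 (by norm_num)]
  change pellDet 3 - X ^ pellNumber 3 * pellDet 2 + X ^ (pellNumber 3 + pellNumber 2) * pellDet 3 = _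
  rw [pellDet_two, pellDet_three]
  simp only [pellNumber]
  ring

lemma pellWord_ne_nil {n : ℕ} (hn : 1 ≤ n) : pellWord n ≠ [] := by
  rcases hn.eq_or_lt with rfl | hn
  · simp [pellWord]
  · obtain ⟨s, hs⟩ := exists_pellWord_eq_cons n hn
    simp [hs]

lemma eval_zero_pellDet {n : ℕ} (hn : 1 ≤ n) : 0 < (pellDet n).eval 0 := by
  rw [pellDet_eq]
  exact eval_signPoly_pos (by norm_num) (pellWord_ne_nil hn)

lemma isLeast_pellTau_of_exists {n : ℕ} {m : ℝ} (h : IsLeast (positiveZeros (pellDet n)) m) :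
    pellTau n = m := h.csInf_eq

lemma pellTau_two : pellTau 2 = 1 ∧ IsLeast (positiveZeros (pellDet 2)) (pellTau 2) := by
  have h : IsLeast (positiveZeros (pellDet 2)) 1 := by
    rw [pellDet_two]
    refine ⟨⟨one_pos, by simp⟩, fun x hx => ?_⟩
    have := hx.2
    simp only [eval_sub, eval_one, eval_X] at this
    linarith
  rw [isLeast_pellTau_of_exists h]
  exact ⟨rfl, h⟩

lemma eval_pellDet_succ_pellTau {n : ℕ} (hn : 2 ≤ n) (h : (pellDet n).eval (pellTau n) = 0) :
    (pellDet (n + 1)).eval (pellTau n) =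
      -(pellTau n ^ pellNumber n * (pellDet (n - 1)).eval (pellTau n)) := by
  rw [pellDet, kneadingDet_pellWord_succ n hn]
  simp only [eval_add, eval_sub, eval_mul, eval_pow, eval_X, h]
  ring

/-- The positivity of D_{n-1} at τ_n is carried along: it makes D_{n+1}(τ_n) negative, so τ_{n+1} <
τ_n, and then D_n is positive at τ_{n+1}, a point before its first zero. -/
lemma isLeast_pellTau_and_pos {n : ℕ} (hn : 2 ≤ n) :
    IsLeast (positiveZeros (pellDet n)) (pellTau n) ∧
      0 < (pellDet (n - 1)).eval (pellTau n) ∧ pellTau (n + 1) < pellTau n := by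
  suffices h : IsLeast (positiveZeros (pellDet n)) (pellTau n) ∧
      0 < (pellDet (n - 1)).eval (pellTau n) by
    refine ⟨h.1, h.2, ?_⟩
    obtain ⟨m, hm, hml⟩ := exists_isLeast_positiveZeros (p := pellDet (n + 1)) (y := pellTau n)
      (eval_zero_pellDet (by omega)) h.1.1.1 (by
        rw [eval_pellDet_succ_pellTau hn h.1.1.2]
        exact neg_neg_of_pos (mul_pos (pow_pos h.1.1.1 _) h.2))
    rwa [isLeast_pellTau_of_exists hml]
  induction n, hn using Nat.le_induction with
  | base =>
    refine ⟨pellTau_two.2, ?_⟩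
    change 0 < (pellDet 1).eval _
    simp [pellDet_one]
  | succ n hn ih =>
    obtain ⟨m, hm, hml⟩ := exists_isLeast_positiveZeros (p := pellDet (n + 1)) (y := pellTau n)
      (eval_zero_pellDet (by omega)) ih.1.1.1 (by
        rw [eval_pellDet_succ_pellTau hn ih.1.1.2]
        exact neg_neg_of_pos (mul_pos (pow_pos ih.1.1.1 _) ih.2))
    rw [isLeast_pellTau_of_exists hml]
    exact ⟨hml, eval_pos_of_lt_isLeast (eval_zero_pellDet (by omega)) ih.1 hml.1.1 hm⟩

lemma isLeast_pellTau {n : ℕ} (hn : 2 ≤ n) : IsLeast (positiveZeros (pellDet n)) (pellTau n) :=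
  (isLeast_pellTau_and_pos hn).1

lemma eval_pellTau {n : ℕ} (hn : 2 ≤ n) : (pellDet n).eval (pellTau n) = 0 :=
  (isLeast_pellTau hn).1.2

lemma pellTau_succ_lt {n : ℕ} (hn : 2 ≤ n) : pellTau (n + 1) < pellTau n :=
  (isLeast_pellTau_and_pos hn).2.2

lemma half_le_pellTau {n : ℕ} (hn : 2 ≤ n) : 1 / 2 ≤ pellTau n := by
  by_contra! h
  have h1 := (isLeast_pellTau hn).1
  have h2 := eval_signPoly_pos ⟨h1.1.le, h⟩ (pellWord_ne_nil (show 1 ≤ n by omega))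
  rw [← pellDet_eq] at h2
  exact h2.ne' h1.2

lemma pellTau_antitone {m n : ℕ} (hm : 2 ≤ m) (hmn : m ≤ n) : pellTau n ≤ pellTau m := by
  induction n, hmn using Nat.le_induction with
  | base => exact le_rfl
  | succ n hmn ih => exact (pellTau_succ_lt (hm.trans hmn)).le.trans ih

lemma pellTau_le_one {n : ℕ} (hn : 2 ≤ n) : pellTau n ≤ 1 :=
  (pellTau_antitone le_rfl hn).trans pellTau_two.1.le

/-- This places all τ_n with n ≥ 3 in [0, 2/3], where the uniform bounds apply. -/
lemma pellTau_three_lt : pellTau 3 < 2 / 3 := by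
  obtain ⟨m, hm, hml⟩ := exists_isLeast_positiveZeros (p := pellDet 3) (y := 2 / 3)
    (eval_zero_pellDet (by omega)) (by norm_num) (by rw [pellDet_three]; norm_num)
  rwa [isLeast_pellTau_of_exists hml]

lemma pellTau_mem_Icc {n : ℕ} (hn : 3 ≤ n) : pellTau n ∈ Icc (1 / 2 : ℝ) (2 / 3) :=
  ⟨half_le_pellTau (by omega), (pellTau_antitone (by norm_num) hn).trans pellTau_three_lt.le⟩

/-! ### Derivatives of the determinants and the ratio of differences -/

lemma exists_pellWord_eq_append {m n : ℕ} (hm : 1 ≤ m) (hmn : m ≤ n) :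
    ∃ s, pellWord n = pellWord m ++ s := by
  induction n, hmn using Nat.le_induction with
  | base => exact ⟨[], by simp⟩
  | succ n hmn ih =>
    obtain ⟨s, hs⟩ := ih
    obtain ⟨k, rfl⟩ := Nat.exists_eq_add_of_le' (hm.trans hmn)
    rcases Nat.eq_zero_or_pos k with rfl | hk
    · obtain rfl : m = 1 := by omega
      exact ⟨[Letter.L], by simp [pellWord, pellSubst, pellSubstLetter]⟩
    · rw [show k + 1 + 1 = k + 2 from rfl, pellWord_concat k hk, hs]
      exact ⟨_, by rw [List.append_assoc, List.append_assoc]⟩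

/-- W_m is a prefix of W_n, and the remainder is again a sign polynomial, bounded independently of
n. -/
lemma exists_pellDet_eq_sub {m n : ℕ} (hm : 1 ≤ m) (hmn : m ≤ n) :
    ∃ s, pellDet n = pellDet m - X ^ pellNumber m * signPoly s := by
  obtain ⟨s, hs⟩ := exists_pellWord_eq_append hm hmn
  refine ⟨s, ?_⟩
  rw [pellDet_eq, pellDet_eq, hs, signPoly_append, wordSign_pellWord m hm, length_pellWord m hm]
  simp
  ring

/-- The derivatives of the kneading determinants converge geometrically on `[0, 2/3]`. -/
lemma abs_eval_derivative_pellDet_sub_le {m n : ℕ} (hm : 1 ≤ m) (hmn : m ≤ n) {x : ℝ}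
    (hx : x ∈ Icc (0 : ℝ) (2 / 3)) :
    |(derivative (pellDet n)).eval x - (derivative (pellDet m)).eval x| ≤
      3 * (pellNumber m * x ^ (pellNumber m - 1)) + 9 * x ^ pellNumber m := by
  obtain ⟨s, hs⟩ := exists_pellDet_eq_sub hm hmn
  have h1 := abs_eval_signPoly_le hx s
  have h2 := abs_eval_derivative_signPoly_le hx s
  have h3 : 0 ≤ (pellNumber m : ℝ) * x ^ (pellNumber m - 1) :=
    mul_nonneg (Nat.cast_nonneg _) (pow_nonneg hx.1 _)
  rw [hs, derivative_sub, eval_sub, sub_sub_cancel_left, abs_neg, derivative_mul,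
    derivative_X_pow, eval_add, eval_mul, eval_mul, eval_mul, eval_C, eval_pow, eval_X, eval_pow,
    eval_X]
  refine (abs_add_le _ _).trans (add_le_add ?_ ?_)
  · rw [abs_mul, abs_of_nonneg h3, mul_comm]
    gcongr
  · rw [abs_mul, abs_of_nonneg (pow_nonneg hx.1 _), mul_comm]
    have := pow_nonneg hx.1 (pellNumber m)
    gcongr

lemma eval_derivative_pellDet_four_le {x : ℝ} (hx : x ∈ Icc (0 : ℝ) (2 / 3)) :
    (derivative (pellDet 4)).eval x ≤ -1 := by
  rw [pellDet_four]
  simp only [derivative_sub, derivative_add, derivative_one, derivative_X, derivative_X_pow,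
    eval_sub, eval_add, eval_mul, eval_pow, eval_X, eval_C, eval_one, eval_zero]
  obtain ⟨h0, h1⟩ := hx
  -- On [0, 2/3] each positive term of the derivative is absorbed by a negative term of lower
  -- degree.
  have e1 : 0 ≤ x * (2 / 3 - x) := mul_nonneg h0 (by linarith)
  have e2 : 0 ≤ x ^ 4 * (2 / 3 - x) := mul_nonneg (by positivity) (by linarith)
  have e3 : x ^ 6 ≤ x ^ 3 * (2 / 3) ^ 3 := by
    rw [show x ^ 6 = x ^ 3 * x ^ 3 by ring]
    gcongr
  have e4 : 0 ≤ x ^ 8 * (2 / 3 - x) := mul_nonneg (by positivity) (by linarith)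
  have e5 : 0 ≤ x ^ 3 := by positivity
  have e6 : 0 ≤ x ^ 4 := by positivity
  have e7 : 0 ≤ x ^ 7 := by positivity
  have e8 : 0 ≤ x ^ 8 := by positivity
  have e9 : 0 ≤ x ^ 10 := by positivity
  norm_num
  nlinarith

/-- The tail after W_4, of length 12, changes the derivative by at most 36 (2/3)^11 + 9 (2/3)^12 <
1/2. -/
lemma eval_derivative_pellDet_le {n : ℕ} (hn : 4 ≤ n) {x : ℝ} (hx : x ∈ Icc (0 : ℝ) (2 / 3)) :
    (derivative (pellDet n)).eval x ≤ -1 / 2 := by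
  have h1 := (abs_le.1 (abs_eval_derivative_pellDet_sub_le (by norm_num) hn hx)).2
  have h2 := eval_derivative_pellDet_four_le hx
  have h3 : x ^ 11 ≤ (2 / 3) ^ 11 := pow_le_pow_left₀ hx.1 hx.2 _
  have h4 : x ^ 12 ≤ (2 / 3) ^ 12 := pow_le_pow_left₀ hx.1 hx.2 _
  simp only [pellNumber] at h1
  norm_num at h1 h3 h4
  linarith

lemma abs_eval_derivative_pellDet_sub_eval_le (n : ℕ) {x y : ℝ} (hx : x ∈ Icc (0 : ℝ) (2 / 3))
    (hy : y ∈ Icc (0 : ℝ) (2 / 3)) :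
    |(derivative (pellDet n)).eval y - (derivative (pellDet n)).eval x| ≤ 54 * |y - x| := by
  have := (convex_Icc (0 : ℝ) (2 / 3)).norm_image_sub_le_of_norm_deriv_le
    (f := fun x => (derivative (pellDet n)).eval x) (C := 54)
    (fun z _ => (derivative (pellDet n)).differentiableAt) (fun z hz => by
      rw [Polynomial.deriv, pellDet_eq]
      exact abs_eval_derivative_derivative_signPoly_le hz _) hx hy
  simpa [Real.norm_eq_abs] using this

lemma exists_eval_sub_eq_mul {p : ℝ[X]} {x y : ℝ} (hxy : x < y) :
    ∃ z ∈ Ioo x y, p.eval y - p.eval x = (derivative p).eval z * (y - x) := by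
  obtain ⟨z, hz, h⟩ := exists_deriv_eq_slope (fun x => p.eval x) hxy p.continuousOn
    p.differentiable.differentiableOn
  refine ⟨z, hz, ?_⟩
  rw [Polynomial.deriv, eq_div_iff (by linarith)] at h
  exact h.symm

/-- The ratio of consecutive differences is `τ_{n+1}^{P_{n+1}}` up to a small relative error. -/
lemma exists_pellDelta_succ_eq {n : ℕ} (hn : 4 ≤ n) :
    ∃ r > 0, pellDelta (n + 1) = pellTau (n + 1) ^ pellNumber (n + 1) * r * pellDelta n ∧
      |r - 1| ≤ 2 * (54 * (pellTau n - pellTau (n + 2)) +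
        (3 * (pellNumber n * (2 / 3) ^ (pellNumber n - 1)) + 9 * (2 / 3) ^ pellNumber n)) := by
  obtain ⟨η, hη, hη'⟩ := exists_eval_sub_eq_mul (p := pellDet n)
    (pellTau_succ_lt (n := n) (by omega))
  obtain ⟨ξ, hξ, hξ'⟩ := exists_eval_sub_eq_mul (p := pellDet (n + 2))
    (pellTau_succ_lt (n := n + 1) (by omega))
  have hn0 := pellTau_mem_Icc (n := n) (by omega)
  have hn1 := pellTau_mem_Icc (n := n + 1) (by omega)
  have hn2 := pellTau_mem_Icc (n := n + 2) (by omega)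
  have hηI : η ∈ Icc (0 : ℝ) (2 / 3) :=
    ⟨by linarith [hη.1, hn1.1], by linarith [hη.2, hn0.2]⟩
  have hξI : ξ ∈ Icc (0 : ℝ) (2 / 3) :=
    ⟨by linarith [hξ.1, hn2.1], by linarith [hξ.2, hn1.2]⟩
  have hdη := eval_derivative_pellDet_le hn hηI
  have hdξ := eval_derivative_pellDet_le (n := n + 2) (by omega) hξI
  rw [eval_pellTau (n := n) (by omega), zero_sub] at hη'
  have hrec := eval_pellDet_succ_pellTau (n := n + 1) (by omega) (eval_pellTau (by omega))
  rw [Nat.add_sub_cancel] at hrec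
  rw [eval_pellTau (n := n + 1 + 1) (by omega), sub_zero, hrec] at hξ'
  set A := (derivative (pellDet n)).eval η
  set B := (derivative (pellDet (n + 2))).eval ξ
  have hB : B ≠ 0 := by intro h; rw [h] at hdξ; norm_num at hdξ
  -- The recursion at τ_{n+1} links the two mean value identities: D_{n+2} equals -τ_{n+1}^{P_{n+1}}
  -- D_n there.
  refine ⟨A / B, div_pos_of_neg_of_neg (by linarith) (by linarith), ?_, ?_⟩
  · rw [pellDelta, pellDelta]
    have : pellTau (n + 1) ^ pellNumber (n + 1) * (A * (pellTau n - pellTau (n + 1))) =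
        B * (pellTau (n + 1) - pellTau (n + 1 + 1)) := by rw [← hη', ← hξ']; ring
    rw [mul_div_assoc', div_mul_eq_mul_div, eq_div_iff hB]
    linarith
  · have h1 := abs_eval_derivative_pellDet_sub_eval_le n hξI hηI
    have h2 := abs_eval_derivative_pellDet_sub_le (by omega : 1 ≤ n) (by omega : n ≤ n + 2) hξI
    have h3 : |η - ξ| ≤ pellTau n - pellTau (n + 2) := by
      rw [abs_le]
      constructor <;> linarith [hη.1, hη.2, hξ.1, hξ.2]
    have h4 : ξ ^ (pellNumber n - 1) ≤ (2 / 3) ^ (pellNumber n - 1) :=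
      pow_le_pow_left₀ hξI.1 hξI.2 _
    have h5 : ξ ^ pellNumber n ≤ (2 / 3) ^ pellNumber n := pow_le_pow_left₀ hξI.1 hξI.2 _
    have h6 : (pellNumber n : ℝ) * ξ ^ (pellNumber n - 1) ≤
        pellNumber n * (2 / 3) ^ (pellNumber n - 1) := by gcongr
    have h7 : |A - B| ≤ 54 * (pellTau n - pellTau (n + 2)) +
        (3 * (pellNumber n * (2 / 3) ^ (pellNumber n - 1)) + 9 * (2 / 3) ^ pellNumber n) := by
      rw [abs_sub_comm] at h2
      have := abs_sub_le A ((derivative (pellDet n)).eval ξ) B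
      linarith
    -- The factor 2 in the error comes from |B| ≥ 1/2.
    rw [div_sub_one hB, abs_div, div_le_iff₀ (abs_pos.2 hB), abs_of_neg (by linarith : B < 0)]
    nlinarith [abs_nonneg (A - B)]

/-! ### Asymptotics of the zeros and of the entropy differences -/

lemma pellNumber_eq (n : ℕ) :
    (pellNumber n : ℝ) = ((1 + √2) ^ n - (1 - √2) ^ n) / (2 * √2) := by
  have h2 : √2 ^ 2 = 2 := Real.sq_sqrt (by norm_num)
  have h0 : √2 ≠ 0 := by positivity
  suffices h : (pellNumber n : ℝ) = ((1 + √2) ^ n - (1 - √2) ^ n) / (2 * √2) ∧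
      (pellNumber (n + 1) : ℝ) = ((1 + √2) ^ (n + 1) - (1 - √2) ^ (n + 1)) / (2 * √2) from h.1
  induction n with
  | zero =>
    refine ⟨by simp [pellNumber], ?_⟩
    simp only [pellNumber, zero_add, pow_one, Nat.cast_one]
    field_simp
    ring
  | succ n ih =>
    refine ⟨ih.2, ?_⟩
    rw [pellNumber]
    push_cast
    rw [ih.1, ih.2, ← mul_div_assoc, ← add_div]
    congr 1
    linear_combination ((1 - √2) ^ n - (1 + √2) ^ n) * h2

lemma le_pellNumber (n : ℕ) : n ≤ pellNumber n := by
  suffices h : n ≤ pellNumber n ∧ n + 1 ≤ pellNumber (n + 1) from h.1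
  induction n with
  | zero => simp [pellNumber]
  | succ n ih =>
    refine ⟨ih.2, ?_⟩
    rw [pellNumber]
    omega

lemma tendsto_pellNumber : Tendsto pellNumber atTop atTop :=
  tendsto_atTop_mono le_pellNumber tendsto_id

lemma exists_tendsto_pellTau :
    ∃ T, Tendsto pellTau atTop (𝓝 T) ∧ 1 / 2 ≤ T ∧ T < 2 / 3 ∧ ∀ n, 2 ≤ n → T ≤ pellTau n := by
  have hanti : Antitone fun n => pellTau (n + 2) := fun m n hmn =>
    pellTau_antitone (by omega) (by omega)
  have hbdd : BddBelow (range fun n => pellTau (n + 2)) :=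
    ⟨1 / 2, by rintro _ ⟨n, rfl⟩; exact half_le_pellTau (by omega)⟩
  have hlim := tendsto_atTop_ciInf hanti hbdd
  have hle : ∀ n, 2 ≤ n → ⨅ n, pellTau (n + 2) ≤ pellTau n := fun n hn => by
    have := ciInf_le hbdd (n - 2)
    rwa [Nat.sub_add_cancel hn] at this
  exact ⟨_, (tendsto_add_atTop_iff_nat 2).1 hlim, le_ciInf fun n => half_le_pellTau (by omega),
    (hle 3 (by norm_num)).trans_lt pellTau_three_lt, hle⟩

lemma pellDelta_pos {n : ℕ} (hn : 2 ≤ n) : 0 < pellDelta n := sub_pos.2 (pellTau_succ_lt hn)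

lemma tendsto_natCast_mul_pow_comp_pellNumber {r : ℝ} (h0 : 0 ≤ r) (h1 : r < 1) :
    Tendsto (fun n => (pellNumber n : ℝ) * r ^ pellNumber n) atTop (𝓝 0) :=
  (tendsto_self_mul_const_pow_of_lt_one h0 h1).comp tendsto_pellNumber

/-- The asymptotic form of the ratio of consecutive differences. -/
lemma exists_tendsto_pellDelta_succ_eq :
    ∃ r : ℕ → ℝ, Tendsto r atTop (𝓝 1) ∧ (∀ n, 0 < r n) ∧ ∀ n, 4 ≤ n →
      pellDelta (n + 1) = pellTau (n + 1) ^ pellNumber (n + 1) * r n * pellDelta n := by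
  have h : ∀ n, ∃ r : ℝ, 0 < r ∧ (4 ≤ n →
      pellDelta (n + 1) = pellTau (n + 1) ^ pellNumber (n + 1) * r * pellDelta n ∧
      |r - 1| ≤ 2 * (54 * (pellTau n - pellTau (n + 2)) +
        (3 * (pellNumber n * (2 / 3) ^ (pellNumber n - 1)) + 9 * (2 / 3) ^ pellNumber n))) := by
    intro n
    by_cases hn : 4 ≤ n
    · obtain ⟨r, hr, h⟩ := exists_pellDelta_succ_eq hn
      exact ⟨r, hr, fun _ => h⟩
    · exact ⟨1, one_pos, fun h => absurd h hn⟩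
  choose r hr h using h
  refine ⟨r, ?_, hr, fun n hn => (h n hn).1⟩
  obtain ⟨T, hT, -⟩ := exists_tendsto_pellTau
  have h1 : Tendsto (fun n => pellTau n - pellTau (n + 2)) atTop (𝓝 0) := by
    simpa using hT.sub ((tendsto_add_atTop_iff_nat 2).2 hT)
  have h2 : Tendsto (fun n => (pellNumber n : ℝ) * (2 / 3) ^ (pellNumber n - 1)) atTop (𝓝 0) := by
    have := (tendsto_natCast_mul_pow_comp_pellNumber (r := 2 / 3) (by norm_num)
      (by norm_num)).const_mul (3 / 2)
    rw [mul_zero] at this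
    refine this.congr' ?_
    filter_upwards [eventually_ge_atTop 1] with n hn
    obtain ⟨k, hk⟩ := Nat.exists_eq_add_of_le' (hn.trans (le_pellNumber n))
    rw [hk, Nat.add_sub_cancel, pow_succ]
    ring
  have h3 : Tendsto (fun n => (2 / 3 : ℝ) ^ pellNumber n) atTop (𝓝 0) :=
    (tendsto_pow_atTop_nhds_zero_of_lt_one (by norm_num) (by norm_num)).comp tendsto_pellNumber
  have h4 := ((h1.const_mul 54).add ((h2.const_mul 3).add (h3.const_mul 9))).const_mul 2
  simp only [mul_zero, add_zero] at h4
  rw [tendsto_iff_norm_sub_tendsto_zero]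
  refine squeeze_zero' (Eventually.of_forall fun n => norm_nonneg _) ?_ h4
  filter_upwards [eventually_ge_atTop 4] with n hn using (h n hn).2

/-- The root of order P_{n+1} turns the power of τ_{n+1} into τ_{n+1} itself and sends the factor
r_n to 1. -/
lemma tendsto_pellDelta_ratio_rpow {T : ℝ} (hT : Tendsto pellTau atTop (𝓝 T)) :
    Tendsto (fun n : ℕ => (pellDelta (n + 1) / pellDelta n) ^ (1 / (pellNumber (n + 1) : ℝ)))
      atTop (𝓝 T) := by
  obtain ⟨r, hr, hr0, h⟩ := exists_tendsto_pellDelta_succ_eq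
  have hp : Tendsto (fun n => (1 : ℝ) / (pellNumber (n + 1) : ℝ)) atTop (𝓝 0) :=
    tendsto_const_nhds.div_atTop
      (tendsto_natCast_atTop_atTop.comp ((tendsto_add_atTop_iff_nat 1).2 tendsto_pellNumber))
  have h1 := ((tendsto_add_atTop_iff_nat 1).2 hT).mul (hr.rpow hp (Or.inl one_ne_zero))
  rw [Real.one_rpow, mul_one] at h1
  refine h1.congr' ?_
  filter_upwards [eventually_ge_atTop 4] with n hn
  have hτ : 0 ≤ pellTau (n + 1) := (half_le_pellTau (by omega)).trans' (by norm_num)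
  have hpn : pellNumber (n + 1) ≠ 0 := by have := le_pellNumber (n + 1); omega
  rw [h n hn, mul_div_assoc, div_self (pellDelta_pos (by omega)).ne', mul_one,
    Real.mul_rpow (pow_nonneg hτ _) (hr0 n).le, one_div, Real.pow_rpow_inv_natCast hτ hpn]

/-- The halving controls the tail τ_n - τ_∞ by 2 δ_n; together with the first limit it allows τ_n to
be replaced by τ_∞ in P_n log τ_n. -/
lemma tendsto_pellNumber_mul_pellDelta :
    Tendsto (fun n => (pellNumber n : ℝ) * pellDelta n) atTop (𝓝 0) ∧
      ∀ᶠ n in atTop, pellDelta (n + 1) ≤ pellDelta n / 2 := by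
  obtain ⟨r, hr, hr0, h⟩ := exists_tendsto_pellDelta_succ_eq
  have hle : ∀ᶠ n in atTop, pellDelta (n + 1) ≤ 2 * (2 / 3) ^ pellNumber (n + 1) * pellDelta n := by
    filter_upwards [hr.eventually_le_const (show (1 : ℝ) < 2 by norm_num),
      eventually_ge_atTop 4] with n hn2 hn
    have hτ := pellTau_mem_Icc (n := n + 1) (by omega)
    have hδ := pellDelta_pos (n := n) (by omega)
    rw [h n hn, mul_comm (2 : ℝ)]
    have := hr0 n
    have := hτ.1
    gcongr
    exact hτ.2
  have hp := (tendsto_add_atTop_iff_nat 1).2 tendsto_pellNumber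
  have hpow : Tendsto (fun n => 2 * (2 / 3 : ℝ) ^ pellNumber (n + 1)) atTop (𝓝 0) := by
    simpa using ((tendsto_pow_atTop_nhds_zero_of_lt_one (r := (2 / 3 : ℝ)) (by norm_num)
      (by norm_num)).comp hp).const_mul 2
  refine ⟨?_, ?_⟩
  · refine (tendsto_add_atTop_iff_nat 1).1 ?_
    have h1 := (((tendsto_add_atTop_iff_nat 1).2 (tendsto_natCast_mul_pow_comp_pellNumber
      (r := 2 / 3) (by norm_num) (by norm_num))).const_mul 2)
    rw [mul_zero] at h1
    refine squeeze_zero' ?_ ?_ h1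
    · filter_upwards [eventually_ge_atTop 4] with n hn
      exact mul_nonneg (Nat.cast_nonneg _) (pellDelta_pos (by omega)).le
    · filter_upwards [hle, eventually_ge_atTop 4] with n hn hn4
      have hδ : pellDelta n ≤ 1 := by
        have h1 := pellTau_mem_Icc (n := n) (by omega)
        have h2 := pellTau_mem_Icc (n := n + 1) (by omega)
        rw [pellDelta]
        linarith [h1.2, h2.1]
      have h3 : pellDelta (n + 1) ≤ 2 * (2 / 3) ^ pellNumber (n + 1) :=
        hn.trans (mul_le_of_le_one_right (by positivity) hδ)
      calc (pellNumber (n + 1) : ℝ) * pellDelta (n + 1)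
          ≤ pellNumber (n + 1) * (2 * (2 / 3) ^ pellNumber (n + 1)) := by gcongr
        _ = _ := by ring
  · filter_upwards [hle, hpow.eventually_le_const (show (0 : ℝ) < 1 / 2 by norm_num),
      eventually_ge_atTop 4] with n hn h2 hn4
    have := pellDelta_pos (n := n) (by omega)
    nlinarith

/-- Once δ halves at each step, τ_n - 2 δ_n is increasing; its limit is also T. -/
lemma eventually_pellTau_sub_le {T : ℝ} (hT : Tendsto pellTau atTop (𝓝 T)) :
    ∀ᶠ n in atTop, pellTau n - T ≤ 2 * pellDelta n := by
  obtain ⟨N, hN⟩ := eventually_atTop.1 tendsto_pellNumber_mul_pellDelta.2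
  have hδ : Tendsto pellDelta atTop (𝓝 0) := by
    have h := hT.sub ((tendsto_add_atTop_iff_nat 1).2 hT)
    rwa [sub_self] at h
  have hv : Tendsto (fun k => pellTau (k + N) - 2 * pellDelta (k + N)) atTop (𝓝 T) := by
    simpa using ((tendsto_add_atTop_iff_nat N).2 (hT.sub (hδ.const_mul 2)))
  have hmono : Monotone fun k => pellTau (k + N) - 2 * pellDelta (k + N) :=
    monotone_nat_of_le_succ fun k => by
      have h1 := hN (k + N) (by omega)
      have h2 : pellTau (k + N + 1) = pellTau (k + N) - pellDelta (k + N) := by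
        rw [pellDelta]; ring
      rw [show k + 1 + N = k + N + 1 by omega, h2]
      linarith
  filter_upwards [eventually_ge_atTop N] with n hn
  have := hmono.ge_of_tendsto hv (n - N)
  rw [Nat.sub_add_cancel hn] at this
  linarith

lemma tendsto_pellNumber_mul_pellTau_sub {T : ℝ} (hT : Tendsto pellTau atTop (𝓝 T))
    (hle : ∀ n, 2 ≤ n → T ≤ pellTau n) :
    Tendsto (fun n => (pellNumber n : ℝ) * (pellTau n - T)) atTop (𝓝 0) := by
  have h := tendsto_pellNumber_mul_pellDelta.1.const_mul 2
  rw [mul_zero] at h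
  refine squeeze_zero' ?_ ?_ h
  · filter_upwards [eventually_ge_atTop 2] with n hn
    exact mul_nonneg (Nat.cast_nonneg _) (sub_nonneg.2 (hle n hn))
  · filter_upwards [eventually_pellTau_sub_le hT] with n hn
    calc (pellNumber n : ℝ) * (pellTau n - T) ≤ pellNumber n * (2 * pellDelta n) := by gcongr
      _ = _ := by ring

/-- `Pₙ hₙ` is asymptotic to `h_∞ (1 + √2)ⁿ / (2 √2)`, with an error that tends to zero. -/
lemma tendsto_pellNumber_mul_log_sub {T : ℝ} (hT : Tendsto pellTau atTop (𝓝 T)) (hT0 : 0 < T)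
    (hle : ∀ n, 2 ≤ n → T ≤ pellTau n) :
    Tendsto (fun n : ℕ => pellNumber n * -Real.log (pellTau n) -
      (1 + √2) ^ n * (-Real.log T / (2 * √2))) atTop (𝓝 0) := by
  have h1 : Tendsto (fun n : ℕ => (pellNumber n : ℝ) * (Real.log (pellTau n) - Real.log T))
      atTop (𝓝 0) := by
    have h := (tendsto_pellNumber_mul_pellTau_sub hT hle).div_const T
    rw [zero_div] at h
    refine squeeze_zero' ?_ ?_ h
    · filter_upwards [eventually_ge_atTop 2] with n hn
      exact mul_nonneg (Nat.cast_nonneg _) (sub_nonneg.2 (Real.log_le_log hT0 (hle n hn)))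
    · filter_upwards [eventually_ge_atTop 2] with n hn
      have hτ := hT0.trans_le (hle n hn)
      rw [mul_div_assoc, ← Real.log_div hτ.ne' hT0.ne']
      gcongr
      refine (Real.log_le_sub_one_of_pos (div_pos hτ hT0)).trans_eq ?_
      rw [sub_div, div_self hT0.ne']
  -- The conjugate term in the closed form of the Pell numbers vanishes in the limit.
  have hs : |1 - √2| < 1 := by
    have h1 : 1 < √2 := Real.lt_sqrt_of_sq_lt (by norm_num)
    have h2 : √2 < 2 := (Real.sqrt_lt' (by norm_num)).2 (by norm_num)
    rw [abs_lt]
    constructor <;> linarith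
  have h2 : Tendsto (fun n : ℕ => (1 - √2) ^ n * (Real.log T / (2 * √2))) atTop (𝓝 0) := by
    simpa using (tendsto_pow_atTop_nhds_zero_of_abs_lt_one hs).mul_const (Real.log T / (2 * √2))
  have h3 := h2.sub h1
  rw [sub_zero] at h3
  refine h3.congr fun n => ?_
  have h4 := pellNumber_eq n
  have : (pellNumber n : ℝ) * Real.log T =
      (1 + √2) ^ n * (Real.log T / (2 * √2)) - (1 - √2) ^ n * (Real.log T / (2 * √2)) := by
    rw [h4]; ring
  rw [neg_div]
  linarith

/-- The inequalities 1 - 1/x ≤ log x ≤ x - 1 at x = τ_n / τ_{n+1} squeeze the quotient between 1/τ_n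
and 1/τ_{n+1}. -/
lemma tendsto_log_sub_div_pellDelta {T : ℝ} (hT : Tendsto pellTau atTop (𝓝 T)) (hT0 : 0 < T) :
    Tendsto (fun n => (Real.log (pellTau n) - Real.log (pellTau (n + 1))) / pellDelta n) atTop
      (𝓝 T⁻¹) := by
  refine tendsto_of_tendsto_of_tendsto_of_le_of_le' (hT.inv₀ hT0.ne')
    (((tendsto_add_atTop_iff_nat 1).2 hT).inv₀ hT0.ne') ?_ ?_
  · filter_upwards [eventually_ge_atTop 2] with n hn
    have h0 : 0 < pellTau n := (isLeast_pellTau hn).1.1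
    have h1 : 0 < pellTau (n + 1) := (isLeast_pellTau (by omega)).1.1
    rw [le_div_iff₀ (pellDelta_pos hn), ← Real.log_div h0.ne' h1.ne']
    refine le_trans (le_of_eq ?_) (Real.one_sub_inv_le_log_of_pos (div_pos h0 h1))
    rw [pellDelta]
    field_simp
  · filter_upwards [eventually_ge_atTop 2] with n hn
    have h0 : 0 < pellTau n := (isLeast_pellTau hn).1.1
    have h1 : 0 < pellTau (n + 1) := (isLeast_pellTau (by omega)).1.1
    rw [div_le_iff₀ (pellDelta_pos hn), ← Real.log_div h0.ne' h1.ne']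
    refine (Real.log_le_sub_one_of_pos (div_pos h0 h1)).trans_eq ?_
    rw [pellDelta]
    field_simp

/-- The logarithm of the ratio of consecutive entropy differences, for `hₙ = -log τₙ`. -/
lemma tendsto_log_ratio_sub {T : ℝ} (hT : Tendsto pellTau atTop (𝓝 T)) (hT0 : 0 < T)
    (hle : ∀ n, 2 ≤ n → T ≤ pellTau n) :
    Tendsto (fun n : ℕ =>
      Real.log ((Real.log (pellTau n) - Real.log (pellTau (n + 1))) /
        (Real.log (pellTau (n + 1)) - Real.log (pellTau (n + 2)))) -
      (1 + √2) ^ (n + 1) * (-Real.log T / (2 * √2))) atTop (𝓝 0) := by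
  obtain ⟨r, hr, hr0, h⟩ := exists_tendsto_pellDelta_succ_eq
  have hg := tendsto_log_sub_div_pellDelta hT hT0
  have hg1 := (tendsto_add_atTop_iff_nat 1).2 hg
  have hTi : T⁻¹ ≠ 0 := inv_ne_zero hT0.ne'
  have h1 := (hg.div (hg1.mul hr) (by rwa [mul_one])).log (by rw [mul_one, div_self hTi]; norm_num)
  rw [mul_one, div_self hTi, Real.log_one] at h1
  have h2 := h1.add ((tendsto_add_atTop_iff_nat 1).2 (tendsto_pellNumber_mul_log_sub hT hT0 hle))
  rw [add_zero] at h2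
  refine h2.congr' ?_
  filter_upwards [eventually_ge_atTop 4] with n hn
  have hτ0 : 0 < pellTau (n + 1) := (isLeast_pellTau (by omega)).1.1
  have hτ2 : 0 < pellTau (n + 2) := (isLeast_pellTau (by omega)).1.1
  have hδ0 := pellDelta_pos (n := n) (by omega)
  have hl0 : 0 < Real.log (pellTau n) - Real.log (pellTau (n + 1)) :=
    sub_pos.2 (Real.log_lt_log hτ0 (pellTau_succ_lt (by omega)))
  have hl1 : 0 < Real.log (pellTau (n + 1)) - Real.log (pellTau (n + 2)) :=
    sub_pos.2 (Real.log_lt_log hτ2 (pellTau_succ_lt (by omega)))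
  have hrn := hr0 n
  -- The left side tends to 1; the logarithm of the right side is that of the ratio minus P_{n+1}
  -- h_{n+1}.
  have key : (Real.log (pellTau n) - Real.log (pellTau (n + 1))) / pellDelta n /
      ((Real.log (pellTau (n + 1)) - Real.log (pellTau (n + 1 + 1))) / pellDelta (n + 1) * r n) =
      (Real.log (pellTau n) - Real.log (pellTau (n + 1))) /
        (Real.log (pellTau (n + 1)) - Real.log (pellTau (n + 2))) *
          pellTau (n + 1) ^ pellNumber (n + 1) := by
    rw [h n hn]
    field_simp
  simp only [Pi.div_apply]
  rw [key, Real.log_mul (div_pos hl0 hl1).ne' (pow_pos hτ0 _).ne', Real.log_pow]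
  ring

lemma tendsto_div_exp_of_tendsto_log_sub {u E : ℕ → ℝ} (hu : ∀ᶠ n in atTop, 0 < u n)
    (h : Tendsto (fun n => Real.log (u n) - E n) atTop (𝓝 0)) :
    Tendsto (fun n => u n / Real.exp (E n)) atTop (𝓝 1) := by
  have h1 := h.rexp
  rw [Real.exp_zero] at h1
  refine h1.congr' ?_
  filter_upwards [hu] with n hn
  rw [Real.exp_sub, Real.exp_log hn]

/-- As E tends to infinity, an additive o(1) error is a relative one, so v / E → 1. -/
lemma tendsto_log_sub_log_of_tendsto_sub {v E : ℕ → ℝ} (hE : Tendsto E atTop atTop)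
    (h : Tendsto (fun n => v n - E n) atTop (𝓝 0)) :
    Tendsto (fun n => Real.log (v n) - Real.log (E n)) atTop (𝓝 0) := by
  have h1 := ((h.div_atTop hE).add_const 1).log (by norm_num)
  rw [zero_add, Real.log_one] at h1
  have hv : Tendsto v atTop atTop := by
    simpa using h.add_atTop hE
  refine h1.congr' ?_
  filter_upwards [hE.eventually_gt_atTop 0, hv.eventually_gt_atTop 0] with n hn hvn
  rw [← Real.log_div hvn.ne' hn.ne', sub_div, div_self hn.ne', sub_add_cancel]

/-! ### Assembly -/

theorem mainTheorem5 :
    -- the words: concatenation rule and lengths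
    (∀ n : ℕ, 1 ≤ n →
      pellWord (n + 2) = pellWord (n + 1) ++ pellWord n ++ pellWord (n + 1)) ∧
    (∀ n : ℕ, 1 ≤ n → (pellWord n).length = pellNumber n) ∧
    -- the recursion for the kneading determinants
    (∀ n : ℕ, 2 ≤ n →
      kneadingDet (pellWord (n + 1)) =
        kneadingDet (pellWord n)
          - Polynomial.X ^ pellNumber n * kneadingDet (pellWord (n - 1))
          + Polynomial.X ^ (pellNumber n + pellNumber (n - 1)) * kneadingDet (pellWord n)) ∧
    -- the smallest positive zeros exist and strictly decrease
    (∀ n : ℕ, 2 ≤ n →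
      IsLeast (positiveZeros (kneadingDet (pellWord n))) (pellTau n) ∧
        pellTau (n + 1) < pellTau n) ∧
    ∃ τinf hinf : ℝ,
      0 < τinf ∧ τinf < 1 ∧ hinf = -Real.log τinf ∧
      Filter.Tendsto pellTau Filter.atTop (nhds τinf) ∧
      Filter.Tendsto
        (fun n : ℕ => (pellDelta (n + 1) / pellDelta n) ^ (1 / (pellNumber (n + 1) : ℝ)))
        Filter.atTop (nhds τinf) ∧
      -- the topological entropies of unimodal maps realising the cascade
      ∀ (f : ℕ → ℝ → ℝ) (a b c h : ℕ → ℝ),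
        (∀ n : ℕ, 1 ≤ n → IsUnimodalOn (f n) (a n) (b n) (c n)) →
        (∀ n : ℕ, 1 ≤ n → HasSuperstableWord (f n) (c n) (pellWord n)) →
        (∀ n : ℕ, h n = (entropyOn (f n) (a n) (b n)).toReal) →
          (∀ n : ℕ, 2 ≤ n →
            entropyOn (f n) (a n) (b n) = ((-Real.log (pellTau n) : ℝ) : EReal)) ∧
          Filter.Tendsto h Filter.atTop (nhds hinf) ∧
          Filter.Tendsto
            (fun n : ℕ =>
              ((h (n + 1) - h n) / (h (n + 2) - h (n + 1))) /
                Real.exp (Real.exp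
                  (((n + 1 : ℕ) : ℝ) * Real.log (1 + Real.sqrt 2)
                    + Real.log (hinf / (2 * Real.sqrt 2)))))
            Filter.atTop (nhds 1) ∧
          Filter.Tendsto
            (fun n : ℕ =>
              Real.log (Real.log ((h (n + 1) - h n) / (h (n + 2) - h (n + 1))))
                - (((n + 1 : ℕ) : ℝ) * Real.log (1 + Real.sqrt 2)
                    + Real.log (hinf / (2 * Real.sqrt 2))))
            Filter.atTop (nhds 0) := by
  obtain ⟨T, hT, hT2, hT3, hle⟩ := exists_tendsto_pellTau
  have hT0 : 0 < T := by linarith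
  refine ⟨pellWord_concat, length_pellWord, kneadingDet_pellWord_succ,
    fun n hn => ⟨isLeast_pellTau hn, pellTau_succ_lt hn⟩, T, -Real.log T, hT0, by linarith, rfl,
    hT, tendsto_pellDelta_ratio_rpow hT, fun f a b c h hf hw hh => ?_⟩
  have hent : ∀ n : ℕ, 2 ≤ n →
      entropyOn (f n) (a n) (b n) = ((-Real.log (pellTau n) : ℝ) : EReal) := by
    intro n hn
    obtain ⟨s, hs⟩ := exists_pellWord_eq_cons n hn
    have h1 := hw n (by omega)
    have h2 := isLeast_pellTau hn
    have h3 := C_notMem_pellWord n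
    rw [pellDet, hs] at h2
    rw [hs] at h1 h3
    exact (hf n (by omega)).entropyOn_eq_neg_log h1 h3 (pellTau_le_one hn) h2
  have hlog : ∀ n : ℕ, 2 ≤ n → h n = -Real.log (pellTau n) := fun n hn => by
    rw [hh n, hent n hn, EReal.toReal_coe]
  have hH : 0 < -Real.log T := neg_pos.2 (Real.log_neg hT0 (by linarith))
  set κ := -Real.log T / (2 * √2) with hκ
  have hκ0 : 0 < κ := by positivity
  -- The inner exponential is (1+√2)^{n+1} κ. The index n + 1 matches the ratio, whose middle
  -- entropy is h_{n+1}.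
  have hE : ∀ n : ℕ, Real.exp (((n + 1 : ℕ) : ℝ) * Real.log (1 + √2) + Real.log κ) =
      (1 + √2) ^ (n + 1) * κ := fun n => by
    rw [Real.exp_add, Real.exp_log hκ0, Real.exp_nat_mul, Real.exp_log (by positivity)]
  have hB : ∀ n : ℕ, ((n + 1 : ℕ) : ℝ) * Real.log (1 + √2) + Real.log κ =
      Real.log ((1 + √2) ^ (n + 1) * κ) := fun n => by rw [← hE, Real.log_exp]
  have hratio : ∀ n : ℕ, 2 ≤ n → (h (n + 1) - h n) / (h (n + 2) - h (n + 1)) =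
      (Real.log (pellTau n) - Real.log (pellTau (n + 1))) /
        (Real.log (pellTau (n + 1)) - Real.log (pellTau (n + 2))) := fun n hn => by
    rw [hlog n hn, hlog (n + 1) (by omega), hlog (n + 2) (by omega)]
    congr 1 <;> ring
  have hpos : ∀ᶠ n in atTop, 0 < (h (n + 1) - h n) / (h (n + 2) - h (n + 1)) := by
    filter_upwards [eventually_ge_atTop 2] with n hn
    rw [hratio n hn]
    exact div_pos
      (sub_pos.2 (Real.log_lt_log (isLeast_pellTau (by omega)).1.1 (pellTau_succ_lt hn)))
      (sub_pos.2 (Real.log_lt_log (isLeast_pellTau (by omega)).1.1 (pellTau_succ_lt (by omega))))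
  have hmain : Tendsto (fun n : ℕ => Real.log ((h (n + 1) - h n) / (h (n + 2) - h (n + 1))) -
      (1 + √2) ^ (n + 1) * κ) atTop (𝓝 0) := by
    refine (tendsto_log_ratio_sub hT hT0 hle).congr' ?_
    filter_upwards [eventually_ge_atTop 2] with n hn
    rw [hratio n hn]
  have hgrow : Tendsto (fun n : ℕ => (1 + √2) ^ (n + 1) * κ) atTop atTop :=
    ((tendsto_add_atTop_iff_nat 1).2 (tendsto_pow_atTop_atTop_of_one_lt
      (lt_add_of_pos_right 1 (by positivity)))).atTop_mul_const hκ0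
  refine ⟨hent, ?_, ?_, ?_⟩
  · refine (hT.log hT0.ne').neg.congr' ?_
    filter_upwards [eventually_ge_atTop 2] with n hn using (hlog n hn).symm
  · simp only [hE]
    exact tendsto_div_exp_of_tendsto_log_sub hpos hmain
  · simp only [hB]
    exact tendsto_log_sub_log_of_tendsto_sub hgrow hmain
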